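/- Let $X$ be a smooth irreducible affine algebraic variety over $\mathbb C$ of dimension $n\ge 2$ with coordinate ring $\mathbb C[X]$, equipped with an algebraic action of a finite group $\Gamma$ and with an algebraic volume form $\omega$ (a nowhere vanishing algebraic $n$-form). Assume that $\omega$ is $\Gamma$-quasi-invariant: there is a character $\chi_\omega:\Gamma\to\mathbb C^*$ with $\gamma^*\omega=\chi_\omega(\gamma)\,\omega$ for all $\gamma\in\Gamma$. Notation. $\mathbb C[X,\Gamma]$ is the ring of $\Gamma$-invariant regular functions. $\mathcal C_k(X,\Gamma)$ is the space of algebraic $k$-forms $\tau$ with $\gamma^*\tau=\chi_\omega(\gamma)\tau$ for all $\gamma\in\Gamma$, and $\mathcal B_k(X,\Gamma)\subset\mathcal C_k(X,\Gamma)$ is the subspace of those $\tau$ that are exact, i.e. $\tau = \mathrm d\sigma$ for some algebraic $(k-1)$-form $\sigma$ on $X$. For an algebraic vector field $\xi$ put $\Theta(\xi)=\iota_\xi\omega$. An algebraic vector field is completely integrable if its holomorphic flow is defined for all complex times, and has $\omega$-divergence zero if $L_\xi\omega=0$. $\mathrm{Lie}^\omega_{\rm alg}(X,\Gamma)$ is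 the complex Lie algebra generated by the $\Gamma$-invariant completely integrable algebraic vector fields of $\omega$-divergence zero. A pair $(\xi,\eta)$ of nonzero $\Gamma$-invariant completely integrable algebraic vector fields is $\Gamma$-semi-compatible if the linear span of the products $fg$ with $f,g\in\mathbb C[X,\Gamma]$, $\xi(f)=0$, $\eta(g)=0$, contains a nonzero ideal of $\mathbb C[X,\Gamma]$; the largest ideal of $\mathbb C[X,\Gamma]$ contained in this span is the associate $\Gamma$-ideal of the pair. For an algebraic subbundle $V\subset\Lambda^2TX$ let $\mathcal C^V_{n-2}(X,\Gamma)$ be the space of those $\tau\in\mathcal C_{n-2}(X,\Gamma)$ such that for every $x\in X$ the value $\tau(x)$ lies in the linear span of the elements $\iota_{v_1}\iota_{v_2}\omega(x)$ with $v_1,v_2\in T_xX$ and $v_1\wedge v_2\in V_x$. Proposition. Let $(\xi_j,\eta_j)_{j=1}^k$ be pairs of $\Gamma$-semi-compatible vector fields on $X$ such that the $(n-1)$-forms $\Theta(\xi_j)$ and $\Theta(\eta_j)$ are exact (differentials of algebraic $(n-2)$-forms on $X$) for every $j$. Let $I_j$ be the associate $\Gamma$-ideal of $(\xi_j,\eta_j)$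 and $I_j(x)=\{f(x): f\in I_j\}$. Let $V$ be an algebraic subbundle of $\Lambda^2TX$ such that (A) for every $x\in X$ the set $\bigcup_{j=1}^k I_j(x)\,\xi_j(x)\wedge\eta_j(x)$ spans the fiber $V_x$. Then $\Theta(\mathrm{Lie}^\omega_{\rm alg}(X,\Gamma))\supset \mathrm d\big(\mathcal C^V_{n-2}(X,\Gamma)\big)$. In particular, if $V=\Lambda^2TX$ (strong Condition (A)), then $\Theta(\mathrm{Lie}^\omega_{\rm alg}(X,\Gamma))\supset\mathcal B_{n-1}(X,\Gamma)$. -/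

import Mathlib

/-!
Conventions. A smooth affine complex variety `X` is given by its coordinate ring `A = ℂ[X]`.
Its points are the `ℂ`-algebra maps `x : A →ₐ[ℂ] ℂ` (evaluation at `x`), the algebraic vector fields
on `X` are the `ℂ`-derivations of `A` with their commutator bracket, and algebraic differential
`k`-forms are the `A`-multilinear alternating functions of `k` vector fields.
An algebraic vector bundle on `X` is given by its module `M` of sections, and its fiber over `x`
is `M / 𝔪ₓ M`.
-/

namespace AffineVar

open Finset

noncomputable section

section Forms

variable (A : Type*) [CommRing A] [Algebra ℂ A]

/-- Algebraic vector fields on the affine variety with coordinate ring `A`. -/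
abbrev VectorField : Type _ := Derivation ℂ A A

/-- Algebraic differential `k`-forms. -/
abbrev Form (k : ℕ) : Type _ := (VectorField A) [⋀^Fin k]→ₗ[A] A

variable {A}

instance instIsScalarTowerForm (k : ℕ) : IsScalarTower ℂ A (Form A k) :=
  ⟨fun c a τ => by ext v; simp⟩

/-- Interior product `ι_ξ τ = τ(ξ, ·, …, ·)`. -/
def interior {k : ℕ} (ξ : VectorField A) (τ : Form A (k + 1)) : Form A k := τ.curryLeft ξ

/-- Lie derivative of a form:
`(L_ξ τ)(v₁, …, v_k) = ξ(τ(v₁, …, v_k)) - ∑ᵢ τ(v₁, …, [ξ, vᵢ], …, v_k)`. -/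
def lieDeriv {k : ℕ} (ξ : VectorField A) (τ : Form A k) : Form A k where
  toFun v := ξ (τ v) - ∑ i, τ (Function.update v i ⁅ξ, v i⁆)
  map_update_add' := by
    intro dec v i x y
    have hdec : dec = instDecidableEqFin k := Subsingleton.elim _ _
    subst hdec
    have key : ∀ j, τ (Function.update (Function.update v i (x + y)) j
          ⁅ξ, Function.update v i (x + y) j⁆)
        = τ (Function.update (Function.update v i x) j ⁅ξ, Function.update v i x j⁆)
        + τ (Function.update (Function.update v i y) j ⁅ξ, Function.update v i y j⁆) := by
      intro j
      by_cases h : j = i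
      · subst h
        simp [lie_add]
      · simp only [Function.update_of_ne h, Function.update_comm (Ne.symm h),
          AlternatingMap.map_update_add]
    simp only [key, sum_add_distrib, AlternatingMap.map_update_add, map_add]
    ring
  map_update_smul' := by
    intro dec v i a x
    have hdec : dec = instDecidableEqFin k := Subsingleton.elim _ _
    subst hdec
    have hlie : ⁅ξ, a • x⁆ = a • ⁅ξ, x⁆ + ξ a • x := by
      ext f
      simp only [Derivation.commutator_apply, Derivation.coe_smul, Pi.smul_apply, smul_eq_mul,
        Derivation.leibniz, Derivation.coe_add, Pi.add_apply]
      ring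
    have key : ∀ j, τ (Function.update (Function.update v i (a • x)) j
          ⁅ξ, Function.update v i (a • x) j⁆)
        = a * τ (Function.update (Function.update v i x) j ⁅ξ, Function.update v i x j⁆)
        + if j = i then ξ a * τ (Function.update v i x) else 0 := by
      intro j
      by_cases h : j = i
      · subst h
        simp [hlie, AlternatingMap.map_update_add, AlternatingMap.map_update_smul]
      · simp only [Function.update_of_ne h, Function.update_comm (Ne.symm h),
          AlternatingMap.map_update_smul, smul_eq_mul, if_neg h, add_zero]
    simp only [key, sum_add_distrib, AlternatingMap.map_update_smul, smul_eq_mul,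
      Derivation.leibniz, ← mul_sum, sum_ite_eq', mem_univ, if_true]
    ring
  map_eq_zero_of_eq' := by
    intro v i j hv hij
    have h0 : τ v = 0 := τ.map_eq_zero_of_eq v hv hij
    have hs : ∑ l, τ (Function.update v l ⁅ξ, v l⁆)
        = τ (Function.update v i ⁅ξ, v i⁆) + τ (Function.update v j ⁅ξ, v j⁆) := by
      refine Fintype.sum_eq_add i j hij ?_
      rintro l ⟨hi, hj⟩
      refine τ.map_eq_zero_of_eq _ ?_ hij
      rw [Function.update_of_ne (Ne.symm hi), Function.update_of_ne (Ne.symm hj), hv]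
    have hsw : Function.update v j ⁅ξ, v j⁆
        = (Function.update v i ⁅ξ, v i⁆) ∘ Equiv.swap i j := by
      funext l
      by_cases hlj : l = j
      · subst hlj
        simp [hv]
      · by_cases hli : l = i
        · subst hli
          simp [Function.update_of_ne hij, Function.update_of_ne (Ne.symm hij), hv]
        · simp [Equiv.swap_apply_of_ne_of_ne hli hlj, Function.update_of_ne hlj,
            Function.update_of_ne hli]
    rw [h0, hs, hsw, τ.map_swap _ hij]
    simp

theorem lieDeriv_apply {k : ℕ} (ξ : VectorField A) (τ : Form A k) (v : Fin k → VectorField A) :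
    lieDeriv ξ τ v = ξ (τ v) - ∑ i, τ (Function.update v i ⁅ξ, v i⁆) := rfl

/-- The differential `da` of a function, as an `A`-linear function of vector fields. -/
def dFun (a : A) : VectorField A →ₗ[A] A where
  toFun ξ := ξ a
  map_add' _ _ := rfl
  map_smul' _ _ := rfl

/-- The form `da ∧ σ`. -/
def dWedge {k : ℕ} (a : A) (σ : Form A k) : Form A (k + 1) :=
  AlternatingMap.alternatizeUncurryFin ((dFun a).smulRight σ)

theorem dWedge_apply {k : ℕ} (a : A) (σ : Form A k) (v : Fin (k + 1) → VectorField A) :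
    dWedge a σ v = ∑ i : Fin (k + 1), (-1 : ℤ) ^ (i : ℕ) • (v i a * σ (i.removeNth v)) := by
  simp [dWedge, AlternatingMap.alternatizeUncurryFin_apply, dFun]

theorem interior_dWedge {k : ℕ} (a : A) (σ : Form A (k + 1)) (ξ : VectorField A) :
    interior ξ (dWedge a σ) = ξ a • σ - dWedge a (interior ξ σ) := by
  ext w
  simp only [interior, AlternatingMap.curryLeft_apply_apply, dWedge_apply, AlternatingMap.sub_apply,
    AlternatingMap.smul_apply, smul_eq_mul]
  rw [Fin.sum_univ_succ, sub_eq_add_neg, ← sum_neg_distrib]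
  congr 1
  · have h : (0 : Fin (k + 2)).removeNth (Matrix.vecCons ξ w) = w := by
      funext l; simp [Fin.removeNth]
    rw [h]; simp
  · refine sum_congr rfl fun j _ => ?_
    have h : (j.succ).removeNth (Matrix.vecCons ξ w) = Matrix.vecCons ξ (j.removeNth w) := by
      funext l
      refine Fin.cases ?_ (fun l' => ?_) l
      · simp [Fin.removeNth]
      · simp [Fin.removeNth]
    rw [h]
    simp [pow_succ]

theorem lieDeriv_smul_field {k : ℕ} (a : A) (ξ : VectorField A) (τ : Form A (k + 1)) :
    lieDeriv (a • ξ) τ = a • lieDeriv ξ τ + dWedge a (interior ξ τ) := by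
  ext v
  have hlie : ∀ η : VectorField A, ⁅a • ξ, η⁆ = a • ⁅ξ, η⁆ + (-η a) • ξ := by
    intro η
    ext f
    simp only [Derivation.commutator_apply, Derivation.coe_smul, Pi.smul_apply, smul_eq_mul,
      Derivation.leibniz, Derivation.coe_add, Pi.add_apply]
    ring
  have hup : ∀ i : Fin (k + 1), τ (Function.update v i ξ)
      = (-1 : ℤ) ^ (i : ℕ) • τ (Matrix.vecCons ξ (i.removeNth v)) := by
    intro i
    have := τ.map_insertNth i ξ (i.removeNth v)
    rw [Fin.insertNth_removeNth] at this
    rw [this]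
  simp only [AlternatingMap.add_apply, AlternatingMap.smul_apply, lieDeriv_apply, dWedge_apply,
    hlie, AlternatingMap.map_update_add, AlternatingMap.map_update_smul, smul_eq_mul, hup, interior,
    AlternatingMap.curryLeft_apply_apply, sum_add_distrib, Derivation.coe_smul, Pi.smul_apply,
    mul_sub, mul_sum, neg_mul, mul_smul_comm, smul_neg]
  rw [sum_neg_distrib]
  ring

theorem lieDeriv_smul_form {k : ℕ} (a : A) (ξ : VectorField A) (τ : Form A k) :
    lieDeriv ξ (a • τ) = a • lieDeriv ξ τ + ξ a • τ := by
  ext v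
  simp only [AlternatingMap.add_apply, AlternatingMap.smul_apply, lieDeriv_apply, smul_eq_mul,
    Derivation.leibniz, ← mul_sum]
  ring

theorem lieDeriv_add_field {k : ℕ} (ξ η : VectorField A) (τ : Form A k) :
    lieDeriv (ξ + η) τ = lieDeriv ξ τ + lieDeriv η τ := by
  ext v
  simp only [AlternatingMap.add_apply, lieDeriv_apply, add_lie, AlternatingMap.map_update_add,
    sum_add_distrib, Derivation.coe_add, Pi.add_apply]
  ring

theorem lieDeriv_add_form {k : ℕ} (ξ : VectorField A) (σ τ : Form A k) :
    lieDeriv ξ (σ + τ) = lieDeriv ξ σ + lieDeriv ξ τ := by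
  ext v
  simp only [AlternatingMap.add_apply, lieDeriv_apply, sum_add_distrib, map_add]
  ring

theorem lieDeriv_smul_complex {k : ℕ} (c : ℂ) (ξ : VectorField A) (τ : Form A k) :
    lieDeriv ξ (c • τ) = c • lieDeriv ξ τ := by
  ext v
  simp only [AlternatingMap.smul_apply, lieDeriv_apply, Derivation.map_smul, smul_sub, smul_sum]

theorem interior_lieDeriv_self {k : ℕ} (ξ : VectorField A) (τ : Form A (k + 1)) :
    interior ξ (lieDeriv ξ τ) = lieDeriv ξ (interior ξ τ) := by
  ext v
  simp only [interior, AlternatingMap.curryLeft_apply_apply, lieDeriv_apply]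
  rw [Fin.sum_univ_succ]
  have h0 : τ (Function.update (Matrix.vecCons ξ v) 0 ⁅ξ, Matrix.vecCons ξ v 0⁆) = 0 := by
    simp only [Matrix.cons_val_zero, lie_self]
    exact τ.map_update_zero _ _
  have hs : ∀ i : Fin k, Function.update (Matrix.vecCons ξ v) i.succ ⁅ξ, Matrix.vecCons ξ v i.succ⁆
      = Matrix.vecCons ξ (Function.update v i ⁅ξ, v i⁆) := by
    intro i
    exact (Fin.cons_update (α := fun _ => VectorField A) ξ v i ⁅ξ, v i⁆).symm
  rw [h0, zero_add]
  simp only [hs]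

/-- An `A`-linear function `F` from vector fields to `k`-forms with `ι_ξ (F ξ) = 0` for all `ξ` is
`ξ ↦ ι_ξ σ` for a unique `(k+1)`-form `σ`; this is that form. -/
def uncurryForm {k : ℕ} (F : VectorField A →ₗ[A] Form A k)
    (hF : ∀ (v : Fin k → VectorField A) (i : Fin k), F (v i) v = 0) : Form A (k + 1) where
  toMultilinearMap :=
    LinearMap.uncurryLeft ((AlternatingMap.toMultilinearMapLM (S := A)).comp F)
  map_eq_zero_of_eq' := by
    intro v i j hv hij
    change F (v 0) (Fin.tail v) = 0
    induction i using Fin.cases with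
    | zero =>
      induction j using Fin.cases with
      | zero => exact absurd rfl hij
      | succ j => rw [hv]; exact hF (Fin.tail v) j
    | succ i =>
      induction j using Fin.cases with
      | zero => rw [← hv]; exact hF (Fin.tail v) i
      | succ j =>
        exact (F (v 0)).map_eq_zero_of_eq (Fin.tail v) hv (fun h => hij (congrArg Fin.succ h))

theorem interior_uncurryForm {k : ℕ} (F : VectorField A →ₗ[A] Form A k)
    (hF : ∀ (v : Fin k → VectorField A) (i : Fin k), F (v i) v = 0) (ξ : VectorField A) :
    interior ξ (uncurryForm F hF) = F ξ := by
  ext v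
  rfl

theorem form_ext {k : ℕ} {σ τ : Form A (k + 1)} (h : ∀ ξ, interior ξ σ = interior ξ τ) :
    σ = τ := by
  ext v
  have := congrArg (fun f : Form A k => f (Fin.tail v)) (h (v 0))
  simp only [interior, AlternatingMap.curryLeft_apply_apply] at this
  have hv : Matrix.vecCons (v 0) (Fin.tail v) = v := Fin.cons_self_tail v
  rwa [hv] at this

theorem vanish_of_interior {k : ℕ} {σ : Form A (k + 1)} {ξ : VectorField A}
    (h : interior ξ σ = 0) (v : Fin (k + 1) → VectorField A) (i : Fin (k + 1)) (hv : v i = ξ) :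
    σ v = 0 := by
  have h1 := σ.map_insertNth i ξ (i.removeNth v)
  rw [← hv, Fin.insertNth_self_removeNth] at h1
  rw [h1, hv]
  have h2 : σ (Matrix.vecCons ξ (i.removeNth v)) = 0 := by
    have := congrArg (fun f : Form A k => f (i.removeNth v)) h
    simpa [interior] using this
  rw [h2, smul_zero]

/-- The differential of a `0`-form. -/
def extDerivZero : Form A 0 →ₗ[ℂ] Form A 1 where
  toFun τ := uncurryForm
    { toFun := fun ξ => lieDeriv ξ τ
      map_add' := fun ξ η => lieDeriv_add_field ξ η τ
      map_smul' := fun a ξ => by ext v; simp [lieDeriv_apply] }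
    (fun _ i => i.elim0)
  map_add' σ τ := form_ext fun ξ => by
    change lieDeriv ξ (σ + τ) = lieDeriv ξ σ + lieDeriv ξ τ
    exact lieDeriv_add_form ξ σ τ
  map_smul' c τ := form_ext fun ξ => by
    change lieDeriv ξ (c • τ) = c • lieDeriv ξ τ
    exact lieDeriv_smul_complex c ξ τ

/-- One step of the recursion by Cartan's formula: from the differential `d` on `k`-forms to the
differential `τ ↦ (ξ ↦ L_ξ τ - d (ι_ξ τ))` on `(k+1)`-forms. -/
def extDerivStep {k : ℕ} (d : Form A k →ₗ[ℂ] Form A (k + 1))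
    (hd : ∀ (a : A) (σ : Form A k), d (a • σ) = a • d σ + dWedge a σ)
    (hi : ∀ (ξ : VectorField A) (σ : Form A (k + 1)),
      interior ξ (d (interior ξ σ)) = lieDeriv ξ (interior ξ σ)) :
    Form A (k + 1) →ₗ[ℂ] Form A (k + 2) where
  toFun τ := uncurryForm
    { toFun := fun ξ => lieDeriv ξ τ - d (interior ξ τ)
      map_add' := fun ξ η => by
        have h : interior (ξ + η) τ = interior ξ τ + interior η τ := map_add τ.curryLeft ξ η
        rw [h, map_add, lieDeriv_add_field]
        abel
      map_smul' := fun a ξ => by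
        have h : interior (a • ξ) τ = a • interior ξ τ := map_smul τ.curryLeft a ξ
        rw [h, hd, lieDeriv_smul_field, RingHom.id_apply, smul_sub]
        abel }
    (fun v i => by
      refine vanish_of_interior (ξ := v i) ?_ v i rfl
      have h : interior (v i) (lieDeriv (v i) τ - d (interior (v i) τ))
          = interior (v i) (lieDeriv (v i) τ) - interior (v i) (d (interior (v i) τ)) := rfl
      change interior (v i) (lieDeriv (v i) τ - d (interior (v i) τ)) = 0
      rw [h, hi, interior_lieDeriv_self, sub_self])
  map_add' σ τ := form_ext fun ξ => by
    change lieDeriv ξ (σ + τ) - d (interior ξ (σ + τ))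
      = (lieDeriv ξ σ - d (interior ξ σ)) + (lieDeriv ξ τ - d (interior ξ τ))
    have h : interior ξ (σ + τ) = interior ξ σ + interior ξ τ := rfl
    rw [h, map_add, lieDeriv_add_form]
    abel
  map_smul' c τ := form_ext fun ξ => by
    change lieDeriv ξ (c • τ) - d (interior ξ (c • τ)) = c • (lieDeriv ξ τ - d (interior ξ τ))
    have h : interior ξ (c • τ) = c • interior ξ τ := rfl
    rw [h, map_smul, lieDeriv_smul_complex, smul_sub]

/-- The exterior derivative with the two properties that the recursion needs. -/
def extDerivAux : (k : ℕ) → { d : Form A k →ₗ[ℂ] Form A (k + 1) //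
    (∀ (a : A) (σ : Form A k), d (a • σ) = a • d σ + dWedge a σ) ∧
    ∀ (ξ : VectorField A) (σ : Form A (k + 1)),
      interior ξ (d (interior ξ σ)) = lieDeriv ξ (interior ξ σ) }
  | 0 => ⟨extDerivZero, fun a σ => form_ext fun ξ => by
      change lieDeriv ξ (a • σ) = a • lieDeriv ξ σ + interior ξ (dWedge a σ)
      rw [lieDeriv_smul_form]
      congr 1
      ext v
      simp [interior, dWedge_apply, Subsingleton.elim _ v], fun ξ σ => rfl⟩
  | k + 1 => ⟨extDerivStep (extDerivAux k).1 (extDerivAux k).2.1 (extDerivAux k).2.2,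
      fun a σ => form_ext fun ξ => by
        change lieDeriv ξ (a • σ) - (extDerivAux k).1 (interior ξ (a • σ))
          = a • (lieDeriv ξ σ - (extDerivAux k).1 (interior ξ σ)) + interior ξ (dWedge a σ)
        have h : interior ξ (a • σ) = a • interior ξ σ := rfl
        rw [h, (extDerivAux k).2.1, lieDeriv_smul_form, interior_dWedge, smul_sub]
        abel,
      fun ξ σ => by
        change lieDeriv ξ (interior ξ σ) - (extDerivAux k).1 (interior ξ (interior ξ σ)) = _
        have h : interior ξ (interior ξ σ) = 0 := σ.curryLeft_same ξ
        rw [h, map_zero, sub_zero]⟩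

/-- The exterior derivative `d` on algebraic `k`-forms. It is given by `(df)(ξ) = ξ(f)` on functions
and by Cartan's formula `ι_ξ (dτ) = L_ξ τ - d (ι_ξ τ)` in positive degrees. -/
def extDeriv {k : ℕ} : Form A k →ₗ[ℂ] Form A (k + 1) := (extDerivAux k).1

theorem interior_extDeriv_zero (ξ : VectorField A) (τ : Form A 0) :
    interior ξ (extDeriv τ) = lieDeriv ξ τ := rfl

theorem interior_extDeriv {k : ℕ} (ξ : VectorField A) (τ : Form A (k + 1)) :
    interior ξ (extDeriv τ) = lieDeriv ξ τ - extDeriv (interior ξ τ) := rfl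

/-- The space of exact `(k+1)`-forms. -/
def exactForms (A : Type*) [CommRing A] [Algebra ℂ A] (k : ℕ) : Submodule ℂ (Form A (k + 1)) :=
  LinearMap.range extDeriv

end Forms

section Fibers

variable {A : Type*} [CommRing A] [Algebra ℂ A]

/-- The fiber over the point `x` of the vector bundle with module of sections `M`. -/
abbrev Fiber (x : A →ₐ[ℂ] ℂ) (M : Type*) [AddCommGroup M] [Module A M] : Type _ :=
  M ⧸ (RingHom.ker x • ⊤ : Submodule A M)

/-- The value `s(x)` of a section `s` at the point `x`. -/
def valueAt (x : A →ₐ[ℂ] ℂ) {M : Type*} [AddCommGroup M] [Module A M] (s : M) : Fiber x M :=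
  Submodule.Quotient.mk s

/-- A family of subspaces `V x` of the fibers of a vector bundle is an (algebraic) subbundle if
near every point there are finitely many algebraic sections whose values form a basis of `V x`. -/
def IsSubbundle {M : Type*} [AddCommGroup M] [Module A M] [Module ℂ M] [IsScalarTower ℂ A M]
    (V : ∀ x : A →ₐ[ℂ] ℂ, Submodule ℂ (Fiber x M)) : Prop :=
  ∀ x₀ : A →ₐ[ℂ] ℂ, ∃ g : A, x₀ g ≠ 0 ∧ ∃ (r : ℕ) (s : Fin r → M), ∀ x : A →ₐ[ℂ] ℂ, x g ≠ 0 →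
    LinearIndependent ℂ (fun i => valueAt x (s i)) ∧
    Submodule.span ℂ (Set.range fun i => valueAt x (s i)) = V x

/-- Algebraic bivector fields: the sections of `Λ² TX`. -/
abbrev Bivector (A : Type*) [CommRing A] [Algebra ℂ A] : Type _ := ⋀[A]^2 (VectorField A)

/-- The bivector field `ξ ∧ η`. -/
def wedge (ξ η : VectorField A) : Bivector A := exteriorPower.ιMulti A 2 ![ξ, η]

/-- `ω` is a volume form on a variety of pure dimension `n`: all tangent spaces have dimension `n`,
and the `n`-form `ω` vanishes nowhere. -/
structure IsVolumeForm {n : ℕ} (ω : Form A n) : Prop where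
  finrank_tangent : ∀ x : A →ₐ[ℂ] ℂ, Module.finrank ℂ (Fiber x (VectorField A)) = n
  ne_zero : ∀ x : A →ₐ[ℂ] ℂ, valueAt x ω ≠ 0

/-- `ξ` is completely integrable: its holomorphic flow exists for all complex times, that is, through
every point of `X` passes an integral curve `φ : ℂ → X` of `ξ`. -/
def IsCompletelyIntegrable (ξ : VectorField A) : Prop :=
  ∀ x : A →ₐ[ℂ] ℂ, ∃ φ : ℂ → (A →ₐ[ℂ] ℂ), φ 0 = x ∧
    ∀ (f : A) (t : ℂ), HasDerivAt (fun s => φ s f) (φ t (ξ f)) t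

/-- `ξ` has `ω`-divergence zero: `L_ξ ω = 0`. -/
def IsDivergenceFree {n : ℕ} (ω : Form A n) (ξ : VectorField A) : Prop := lieDeriv ξ ω = 0

end Fibers

section GroupAction

variable {A : Type*} [CommRing A] [Algebra ℂ A]
  {Γ : Type*} [Group Γ] [MulSemiringAction Γ A] [SMulCommClass Γ ℂ A]

/-- The vector field `ξ` transported by the automorphism `f ↦ γ • f` of `A`. -/
def transport (γ : Γ) (ξ : VectorField A) : VectorField A :=
  Derivation.mk'
    { toFun := fun f => γ • ξ (γ⁻¹ • f)
      map_add' := fun f g => by simp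
      map_smul' := fun c f => by
        rw [smul_comm γ⁻¹ c f, Derivation.map_smul, smul_comm γ c, RingHom.id_apply] }
    (fun f g => by simp [smul_mul', Derivation.leibniz])

/-- The action of `γ` on forms: `(γ • τ)(v₁, …, v_k) = γ • τ(γ⁻¹ • v₁, …, γ⁻¹ • v_k)`, which is the
pullback of `τ` along the automorphism of `X` given by `f ↦ γ • f`. -/
def formAction {k : ℕ} (γ : Γ) (τ : Form A k) : Form A k where
  toFun v := γ • τ (fun i => transport γ⁻¹ (v i))
  map_update_add' := by
    intro dec v i x y
    have hdec : dec = instDecidableEqFin k := Subsingleton.elim _ _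
    subst hdec
    have h : ∀ z : VectorField A, (fun l => transport γ⁻¹ (Function.update v i z l))
        = Function.update (fun l => transport γ⁻¹ (v l)) i (transport γ⁻¹ z) := fun z => by
      funext l
      exact Function.apply_update (fun _ => transport γ⁻¹) v i z l
    have h2 : transport γ⁻¹ (x + y) = transport γ⁻¹ x + transport γ⁻¹ y := by
      ext f; simp [transport]
    rw [h, h, h, h2, AlternatingMap.map_update_add, smul_add]
  map_update_smul' := by
    intro dec v i a x
    have hdec : dec = instDecidableEqFin k := Subsingleton.elim _ _
    subst hdec
    have h : ∀ z : VectorField A, (fun l => transport γ⁻¹ (Function.update v i z l))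
        = Function.update (fun l => transport γ⁻¹ (v l)) i (transport γ⁻¹ z) := fun z => by
      funext l
      exact Function.apply_update (fun _ => transport γ⁻¹) v i z l
    have h2 : transport γ⁻¹ (a • x) = (γ⁻¹ • a) • transport γ⁻¹ x := by
      ext f; simp [transport, smul_mul']
    rw [h, h, h2, AlternatingMap.map_update_smul, smul_eq_mul, smul_mul', smul_inv_smul,
      smul_eq_mul]
  map_eq_zero_of_eq' := by
    intro v i j hv hij
    change γ • τ (fun i => transport γ⁻¹ (v i)) = 0
    rw [τ.map_eq_zero_of_eq _ (congrArg (transport γ⁻¹) hv) hij, smul_zero]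

/-- The `Γ`-quasi-invariant `k`-forms for the character `χ`. -/
def quasiInvariantForms (A : Type*) [CommRing A] [Algebra ℂ A] [MulSemiringAction Γ A]
    [SMulCommClass Γ ℂ A] (χ : Γ →* ℂˣ) (k : ℕ) : Set (Form A k) :=
  {τ | ∀ γ : Γ, formAction γ τ = (χ γ : ℂ) • τ}

/-- The exact `Γ`-quasi-invariant `(k+1)`-forms for the character `χ`. -/
def exactQuasiInvariantForms (A : Type*) [CommRing A] [Algebra ℂ A] [MulSemiringAction Γ A]
    [SMulCommClass Γ ℂ A] (χ : Γ →* ℂˣ) (k : ℕ) : Set (Form A (k + 1)) :=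
  {τ | τ ∈ quasiInvariantForms A χ (k + 1) ∧ τ ∈ exactForms A k}

variable (Γ)

/-- The ring `ℂ[X, Γ]` of `Γ`-invariant regular functions. -/
abbrev Invariants (A : Type*) [CommRing A] [Algebra ℂ A] [MulSemiringAction Γ A]
    [SMulCommClass Γ ℂ A] : Subalgebra ℂ A := FixedPoints.subalgebra ℂ A Γ

/-- `ξ` is `Γ`-invariant. -/
def IsInvariantField (ξ : VectorField A) : Prop := ∀ (γ : Γ) (f : A), ξ (γ • f) = γ • ξ f

/-- The invariant functions in the kernel of `ξ`. -/
def invariantKer (ξ : VectorField A) : Submodule ℂ (Invariants Γ A) where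
  carrier := {f | ξ (f : A) = 0}
  add_mem' {f g} hf hg := by
    change ξ ((f : A) + (g : A)) = 0
    rw [map_add, show ξ (f : A) = 0 from hf, show ξ (g : A) = 0 from hg, add_zero]
  zero_mem' := map_zero ξ
  smul_mem' c f hf := by
    change ξ (c • (f : A)) = 0
    rw [Derivation.map_smul, show ξ (f : A) = 0 from hf, smul_zero]

/-- The `ℂ`-linear span of the products of a `Γ`-invariant function in the kernel of `ξ` and a
`Γ`-invariant function in the kernel of `η`. -/
def kerProductSpan (ξ η : VectorField A) : Submodule ℂ (Invariants Γ A) :=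
  Submodule.span ℂ {h | ∃ f ∈ invariantKer Γ ξ, ∃ g ∈ invariantKer Γ η, h = f * g}

/-- The pair `(ξ, η)` is `Γ`-semi-compatible. -/
structure IsSemiCompatible (ξ η : VectorField A) : Prop where
  ne_zero_left : ξ ≠ 0
  ne_zero_right : η ≠ 0
  integrable_left : IsCompletelyIntegrable ξ
  integrable_right : IsCompletelyIntegrable η
  invariant_left : IsInvariantField Γ ξ
  invariant_right : IsInvariantField Γ η
  exists_ideal : ∃ J : Ideal (Invariants Γ A), J ≠ ⊥ ∧
    (J : Set (Invariants Γ A)) ⊆ kerProductSpan Γ ξ η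

/-- The associate `Γ`-ideal of `(ξ, η)`: the largest ideal of `ℂ[X, Γ]` contained in the span. -/
def associateIdeal (ξ η : VectorField A) : Ideal (Invariants Γ A) :=
  sSup {J | (J : Set (Invariants Γ A)) ⊆ kerProductSpan Γ ξ η}

theorem associateIdeal_isGreatest (ξ η : VectorField A) :
    IsGreatest {J : Ideal (Invariants Γ A) | (J : Set (Invariants Γ A)) ⊆ kerProductSpan Γ ξ η}
      (associateIdeal Γ ξ η) := by
  refine ⟨?_, fun J hJ => le_sSup hJ⟩
  intro f hf
  rw [associateIdeal, sSup_eq_iSup'] at hf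
  exact Submodule.iSup_induction _ (motive := fun f => f ∈ kerProductSpan Γ ξ η) hf
    (fun J _ hf => J.2 hf) (zero_mem _) (fun _ _ hf hg => add_mem hf hg)

/-- The Lie algebra generated by the `Γ`-invariant completely integrable algebraic vector fields
of `ω`-divergence zero. -/
def volumeLieAlg {n : ℕ} (ω : Form A n) : LieSubalgebra ℂ (VectorField A) :=
  LieSubalgebra.lieSpan ℂ (VectorField A)
    {ξ | IsInvariantField Γ ξ ∧ IsCompletelyIntegrable ξ ∧ IsDivergenceFree ω ξ}

variable {Γ}

/-- The `Γ`-quasi-invariant `(n-2)`-forms `τ` of the bundle dual to `V ⊆ Λ² TX`, where `n = m + 2`: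
for every point `x`, the value `τ(x)` is in the span of the `ι_v ι_w ω(x)` with `v ∧ w ∈ V x`.
Every pair of tangent vectors at `x` is the pair of values of two vector fields `ξ`, `η`. -/
def dualForms {m : ℕ} (χ : Γ →* ℂˣ) (ω : Form A (m + 2))
    (V : ∀ x : A →ₐ[ℂ] ℂ, Submodule ℂ (Fiber x (Bivector A))) : Set (Form A m) :=
  {τ | τ ∈ quasiInvariantForms A χ m ∧ ∀ x : A →ₐ[ℂ] ℂ,
    valueAt x τ ∈ Submodule.span ℂ {θ : Fiber x (Form A m) | ∃ ξ η : VectorField A,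
      valueAt x (wedge ξ η) ∈ V x ∧ θ = valueAt x (interior ξ (interior η ω))}}

end GroupAction

end

end AffineVar

/-! The mechanism is the bracket formula `ι_[ξ,η] ω = d (ι_ξ ι_η ω)` for divergence-free `ξ`, `η`
(`IsVolumeForm.interior_lie`). If `ξ f = 0` and `η g = 0` with `f`, `g` invariant, then `f ξ` and `g
η` are again invariant, completely integrable and divergence-free, and their bracket contributes `d
(f g ι_ξ ι_η ω)`. By linearity, `d (h ι_ξⱼ ι_ηⱼ ω)` comes from the Lie algebra for every `h` in the
associate ideal `Iⱼ` (`IsVolumeForm.exists_field_of_mem_kerProductSpan`).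

It remains to write a given `τ` as a sum of forms `h ι_ξⱼ ι_ηⱼ ω` with `h ∈ Iⱼ`. Condition (A) gives
this at each point, because contraction with `ω` carries `V x` to the space containing the value of
`τ`. Contraction is injective on fibers (`contract_injective`), so the images of the `V x` have
locally constant rank. Constant rank turns the pointwise statement into a local one, and the
Nullstellensatz glues the local statements: `τ` is a combination with coefficients in `A`
(`IsVolumeForm.mem_span_contract`). Averaging over `Γ` with the weights `χ⁻¹` fixes `τ` and replaces
each coefficient `a` by its invariant average (`quasiAverage_smul`). Since `Iⱼ` is an ideal, it
absorbs that average.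

When `V` is everything, the pointwise condition holds for every form of degree `n - 2`. A primitive
of a quasi-invariant exact form can be averaged because averaging commutes with `d`. -/

namespace AffineVar
open Finset
noncomputable section

/-! ### Cartan calculus -/

section Calculus

variable {A : Type*} [CommRing A] [Algebra ℂ A]

theorem interior_lieDeriv {k : ℕ} (ξ η : VectorField A) (τ : Form A (k + 1)) :
    interior η (lieDeriv ξ τ) = lieDeriv ξ (interior η τ) - interior ⁅ξ, η⁆ τ := by
  ext v
  simp only [interior, AlternatingMap.curryLeft_apply_apply, lieDeriv_apply,
    AlternatingMap.sub_apply]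
  rw [Fin.sum_univ_succ]
  have h0 : Function.update (Matrix.vecCons η v) 0 ⁅ξ, Matrix.vecCons η v 0⁆
      = Matrix.vecCons ⁅ξ, η⁆ v := by
    funext l
    refine Fin.cases ?_ (fun l' => ?_) l <;> simp
  have hs : ∀ i : Fin k, Function.update (Matrix.vecCons η v) i.succ ⁅ξ, Matrix.vecCons η v i.succ⁆
      = Matrix.vecCons η (Function.update v i ⁅ξ, v i⁆) := fun i =>
    (Fin.cons_update (α := fun _ => VectorField A) η v i ⁅ξ, v i⁆).symm
  simp only [h0, hs]
  ring

theorem interior_sub {k : ℕ} (ξ : VectorField A) (σ τ : Form A (k + 1)) :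
    interior ξ (σ - τ) = interior ξ σ - interior ξ τ := rfl

theorem interior_smul_form {k : ℕ} (ξ : VectorField A) (a : A) (τ : Form A (k + 1)) :
    interior ξ (a • τ) = a • interior ξ τ := rfl

theorem interior_smul_field {k : ℕ} (ξ : VectorField A) (a : A) (τ : Form A (k + 1)) :
    interior (a • ξ) τ = a • interior ξ τ := map_smul τ.curryLeft a ξ

theorem interior_add_field {k : ℕ} (ξ η : VectorField A) (τ : Form A (k + 1)) :
    interior (ξ + η) τ = interior ξ τ + interior η τ := map_add τ.curryLeft ξ η

theorem interior_smul_complex {k : ℕ} (ξ : VectorField A) (c : ℂ) (τ : Form A (k + 1)) :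
    interior (c • ξ) τ = c • interior ξ τ := by
  rw [← algebraMap_smul A c ξ, interior_smul_field, algebraMap_smul]

theorem lieDeriv_sub_form {k : ℕ} (ξ : VectorField A) (σ τ : Form A k) :
    lieDeriv ξ (σ - τ) = lieDeriv ξ σ - lieDeriv ξ τ := by
  rw [eq_sub_iff_add_eq, ← lieDeriv_add_form, sub_add_cancel]

/-- Contracting with a test field lowers the degree, so induction applies; the leftover contractions
cancel by the Jacobi identity. -/
theorem lieDeriv_lie {k : ℕ} (ξ η : VectorField A) (τ : Form A k) :
    lieDeriv ξ (lieDeriv η τ) - lieDeriv η (lieDeriv ξ τ) = lieDeriv ⁅ξ, η⁆ τ := by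
  induction k with
  | zero =>
    ext v
    simp [lieDeriv_apply, Derivation.commutator_apply]
  | succ k ih =>
    refine form_ext fun ζ => ?_
    have hj : interior ⁅⁅ξ, η⁆, ζ⁆ τ = interior ⁅ξ, ⁅η, ζ⁆⁆ τ - interior ⁅η, ⁅ξ, ζ⁆⁆ τ := by
      rw [lie_lie]
      exact map_sub τ.curryLeft _ _
    simp only [interior_sub, interior_lieDeriv, lieDeriv_sub_form, ← ih (interior ζ τ), hj]
    abel

/-- After contraction with a test field, Cartan's formula reduces the claim to `lieDeriv_lie` and
the same claim one degree lower. -/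
theorem extDeriv_lieDeriv {k : ℕ} (ξ : VectorField A) (τ : Form A k) :
    extDeriv (lieDeriv ξ τ) = lieDeriv ξ (extDeriv τ) := by
  induction k with
  | zero =>
    refine form_ext fun η => ?_
    rw [interior_lieDeriv, interior_extDeriv_zero, interior_extDeriv_zero, interior_extDeriv_zero,
      ← lieDeriv_lie ξ η]
    abel
  | succ k ih =>
    refine form_ext fun η => ?_
    rw [interior_lieDeriv, interior_extDeriv, interior_extDeriv, interior_extDeriv,
      ← lieDeriv_lie ξ η, interior_lieDeriv, map_sub, ih, lieDeriv_sub_form]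
    abel

theorem extDeriv_extDeriv {k : ℕ} (τ : Form A k) : extDeriv (extDeriv τ) = 0 := by
  induction k with
  | zero =>
    refine form_ext fun ξ => ?_
    rw [interior_extDeriv, interior_extDeriv_zero, extDeriv_lieDeriv, sub_self]
    rfl
  | succ k ih =>
    refine form_ext fun ξ => ?_
    rw [interior_extDeriv, interior_extDeriv, map_sub, ih, extDeriv_lieDeriv, sub_zero, sub_self]
    rfl

end Calculus

/-! ### Points, fibers and local-to-global principles -/

section Points

variable {A : Type*} [CommRing A] [Algebra ℂ A]

/-- Nullstellensatz: the residue field is finite over the algebraically closed field `ℂ`, hence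
equal to it. -/
theorem exists_ker_eq_of_isMaximal [Algebra.FiniteType ℂ A] (I : Ideal A) [hI : I.IsMaximal] :
    ∃ x : A →ₐ[ℂ] ℂ, RingHom.ker x = I := by
  let := Ideal.Quotient.field I
  have : Algebra.FiniteType ℂ (A ⧸ I) :=
    .of_surjective (Ideal.Quotient.mkₐ ℂ I) (Ideal.Quotient.mkₐ_surjective ℂ I)
  have : Module.Finite ℂ (A ⧸ I) := finite_of_finite_type_of_isJacobsonRing ℂ (A ⧸ I)
  have hbij : Function.Bijective (algebraMap ℂ (A ⧸ I)) :=
    IsAlgClosed.algebraMap_bijective_of_isIntegral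
  let e : ℂ ≃ₐ[ℂ] (A ⧸ I) := AlgEquiv.ofBijective (Algebra.ofId ℂ (A ⧸ I)) hbij
  refine ⟨(e.symm : (A ⧸ I) →ₐ[ℂ] ℂ).comp (Ideal.Quotient.mkₐ ℂ I), ?_⟩
  ext a
  rw [RingHom.mem_ker]
  change e.symm (Ideal.Quotient.mk I a) = 0 ↔ _
  rw [map_eq_zero_iff _ e.symm.injective, Ideal.Quotient.eq_zero_iff_mem]

theorem eq_zero_of_forall_point [Algebra.FiniteType ℂ A] [IsReduced A] {a : A}
    (h : ∀ x : A →ₐ[ℂ] ℂ, x a = 0) : a = 0 := by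
  have : IsJacobsonRing A := isJacobsonRing_of_finiteType (A := ℂ)
  have hrad : (⊥ : Ideal A).IsRadical := Ideal.isRadical_bot
  have hj := IsJacobsonRing.out ‹_› hrad
  have : a ∈ (⊥ : Ideal A).jacobson := by
    rw [Ideal.jacobson, Submodule.mem_sInf]
    rintro J ⟨-, hJ⟩
    obtain ⟨x, hx⟩ := exists_ker_eq_of_isMaximal J
    rw [← hx]
    exact h x
  rw [hj] at this
  exact this

/-- The ideal of all `a` with `a • t ∈ N` lies in no maximal ideal, so it contains `1`. -/
theorem mem_of_forall_point [Algebra.FiniteType ℂ A] {M : Type*} [AddCommGroup M] [Module A M]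
    (N : Submodule A M) (t : M)
    (h : ∀ x : A →ₐ[ℂ] ℂ, ∃ a : A, x a ≠ 0 ∧ a • t ∈ N) : t ∈ N := by
  by_contra hn
  have hne : N.comap (LinearMap.toSpanSingleton A M t) ≠ ⊤ := by
    intro htop
    have : (1 : A) ∈ N.comap (LinearMap.toSpanSingleton A M t) := htop ▸ Submodule.mem_top
    exact hn (by simpa using this)
  obtain ⟨I, hI, hle⟩ := Ideal.exists_le_maximal (N.comap (LinearMap.toSpanSingleton A M t)) hne
  obtain ⟨x, hx⟩ := exists_ker_eq_of_isMaximal I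
  obtain ⟨a, ha, hat⟩ := h x
  have : a ∈ I := hle (by simpa using hat)
  rw [← hx] at this
  exact ha this

/-- Smoothness makes the Kähler differentials finite projective, and vector fields are their dual.
-/
theorem exists_dual_basis_vectorField [Algebra.Smooth ℂ A] :
    ∃ (N : ℕ) (v : Fin N → VectorField A) (φ : Fin N → VectorField A →ₗ[A] A),
      ∀ ξ, ξ = ∑ i, φ i ξ • v i := by
  let e := KaehlerDifferential.linearMapEquivDerivation (M := A) ℂ A
  have : Module.Finite A (VectorField A) :=
    Module.Finite.equiv (M := Module.Dual A (Ω[A⁄ℂ])) e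
  have : Module.Projective A (VectorField A) :=
    Module.Projective.of_equiv (M := Module.Dual A (Ω[A⁄ℂ])) e
  obtain ⟨N, f, g, -, -, hfg⟩ := Module.Finite.exists_comp_eq_id_of_projective A (VectorField A)
  refine ⟨N, fun i => f (Pi.single i 1), fun i => (LinearMap.proj i).comp g, fun ξ => ?_⟩
  conv_lhs => rw [← LinearMap.id_apply (R := A) ξ, ← hfg, LinearMap.comp_apply,
    pi_eq_sum_univ' (g ξ), map_sum]
  exact sum_congr rfl fun i _ => map_smul f _ _

/-- Expanding all arguments of `τ` in the dual basis gives multilinear terms that need not be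
alternating; alternatizing both sides and dividing by `k!` repairs this. -/
theorem exists_dual_basis_form [Algebra.Smooth ℂ A] (k : ℕ) :
    ∃ (N : ℕ) (w : (Fin k → Fin N) → Fin k → VectorField A) (β : (Fin k → Fin N) → Form A k),
      ∀ τ : Form A k, τ = ∑ I, τ (w I) • β I := by
  obtain ⟨N, v, φ, hφ⟩ := exists_dual_basis_vectorField (A := A)
  let P : (Fin k → Fin N) → MultilinearMap A (fun _ : Fin k => VectorField A) A := fun I =>
    (MultilinearMap.mkPiAlgebra A (Fin k) A).compLinearMap fun i => φ (I i)
  refine ⟨N, fun I i => v (I i),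
    fun I => ((k.factorial : ℂ)⁻¹) • MultilinearMap.alternatization (P I), fun τ => ?_⟩
  have h1 : (τ : MultilinearMap A (fun _ : Fin k => VectorField A) A)
      = ∑ I, τ (fun i => v (I i)) • P I := by
    ext u
    conv_lhs => rw [show u = fun i => ∑ j, φ j (u i) • v j from funext fun i => hφ (u i)]
    rw [MultilinearMap.map_sum]
    simp [MultilinearMap.map_smul_univ, P, mul_comm]
  have h2 := congrArg MultilinearMap.alternatization h1
  rw [AlternatingMap.coe_alternatization, map_sum, Fintype.card_fin] at h2
  have h3 : τ = ((k.factorial : ℂ)⁻¹) • (k.factorial • τ) := by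
    rw [← Nat.cast_smul_eq_nsmul ℂ, smul_smul, inv_mul_cancel₀, one_smul]
    exact_mod_cast k.factorial_ne_zero
  conv_lhs => rw [h3, h2, smul_sum]
  refine sum_congr rfl fun I _ => ?_
  rw [smul_comm]
  congr 1
  ext u
  simp [MultilinearMap.alternatization_apply, mul_sum, mul_smul_comm]

theorem finite_form [Algebra.Smooth ℂ A] (k : ℕ) : Module.Finite A (Form A k) := by
  obtain ⟨N, w, β, hβ⟩ := exists_dual_basis_form (A := A) k
  classical
  refine Module.finite_def.2 ⟨univ.image β, eq_top_iff.2 fun τ _ => ?_⟩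
  rw [hβ τ]
  exact sum_mem fun I _ => Submodule.smul_mem _ _ (Submodule.subset_span (by simp))

/-- The coefficients of `τ` in the dual basis are values of `τ` on fields. This reconciles vanishing
at `x` as a function with vanishing in the fiber. -/
theorem form_mem_ker_smul_top [Algebra.Smooth ℂ A] {k : ℕ} (x : A →ₐ[ℂ] ℂ) {τ : Form A k}
    (h : ∀ v, x (τ v) = 0) : τ ∈ (RingHom.ker x • ⊤ : Submodule A (Form A k)) := by
  obtain ⟨N, w, β, hβ⟩ := exists_dual_basis_form (A := A) k
  rw [hβ τ]
  exact sum_mem fun I _ => Submodule.smul_mem_smul (h _) trivial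

theorem apply_eq_zero_of_mem_ker_smul_top {k : ℕ} (x : A →ₐ[ℂ] ℂ) {τ : Form A k}
    (h : τ ∈ (RingHom.ker x • ⊤ : Submodule A (Form A k))) (v : Fin k → VectorField A) :
    x (τ v) = 0 := by
  induction h using Submodule.smul_induction_on' with
  | smul a ha σ _ =>
    rw [AlternatingMap.smul_apply, smul_eq_mul, map_mul, (RingHom.mem_ker).1 ha, zero_mul]
  | add σ _ ρ _ h1 h2 => rw [AlternatingMap.add_apply, map_add, h1, h2, add_zero]

theorem apply_eq_zero_of_field_mem_ker_smul_top {k : ℕ} (x : A →ₐ[ℂ] ℂ) (τ : Form A k)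
    (v : Fin k → VectorField A) (i : Fin k)
    (h : v i ∈ (RingHom.ker x • ⊤ : Submodule A (VectorField A))) : x (τ v) = 0 := by
  have key : ∀ u ∈ (RingHom.ker x • ⊤ : Submodule A (VectorField A)),
      x (τ (Function.update v i u)) = 0 := by
    intro u hu
    induction hu using Submodule.smul_induction_on' with
    | smul a ha σ _ =>
      rw [AlternatingMap.map_update_smul, smul_eq_mul, map_mul, (RingHom.mem_ker).1 ha, zero_mul]
    | add σ _ ρ _ h1 h2 => rw [AlternatingMap.map_update_add, map_add, h1, h2, add_zero]
  simpa using key _ h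

theorem smul_sub_smul_mem (x : A →ₐ[ℂ] ℂ) {M : Type*} [AddCommGroup M] [Module A M] [Module ℂ M]
    [IsScalarTower ℂ A M] (a : A) (s : M) :
    a • s - x a • s ∈ (RingHom.ker x • ⊤ : Submodule A M) := by
  rw [← algebraMap_smul A (x a) s, ← sub_smul]
  exact Submodule.smul_mem_smul (by simp [RingHom.mem_ker]) trivial

theorem valueAt_smul (x : A →ₐ[ℂ] ℂ) {M : Type*} [AddCommGroup M] [Module A M] [Module ℂ M]
    [IsScalarTower ℂ A M] (a : A) (s : M) : valueAt x (a • s) = x a • valueAt x s :=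
  (Submodule.Quotient.eq _).2 (smul_sub_smul_mem x a s)

/-- Evaluation of sections at a point, as a complex linear map. -/
def evalAt (x : A →ₐ[ℂ] ℂ) (M : Type*) [AddCommGroup M] [Module A M] [Module ℂ M]
    [IsScalarTower ℂ A M] : M →ₗ[ℂ] Fiber x M where
  toFun := valueAt x
  map_add' _ _ := rfl
  map_smul' _ _ := rfl

theorem valueAt_surjective (x : A →ₐ[ℂ] ℂ) (M : Type*) [AddCommGroup M] [Module A M] :
    Function.Surjective (valueAt x : M → Fiber x M) := Submodule.Quotient.mk_surjective _

theorem valueAt_eq_zero_iff (x : A →ₐ[ℂ] ℂ) {M : Type*} [AddCommGroup M] [Module A M] (s : M) :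
    valueAt x s = 0 ↔ s ∈ (RingHom.ker x • ⊤ : Submodule A M) :=
  Submodule.Quotient.mk_eq_zero _

end Points

/-! ### Linear algebra: contracting bivectors into a top-degree form -/

section Frames

theorem alternatingMap_sum_apply {R M N ι κ : Type*} [CommRing R] [AddCommGroup M] [Module R M]
    [AddCommGroup N] [Module R N] (s : Finset κ) (f : κ → M [⋀^ι]→ₗ[R] N) (v : ι → M) :
    (∑ i ∈ s, f i) v = ∑ i ∈ s, f i v := by
  classical
  induction s using Finset.induction_on with
  | empty => simp
  | insert i s hi ih => rw [sum_insert hi, sum_insert hi, AlternatingMap.add_apply, ih]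

/-- Two vectors contracted into an alternating map: `(v₀, v₁) ↦ α(v₁, v₀, ·)`. -/
def contractPair {R M N : Type*} [CommRing R] [AddCommGroup M] [Module R M] [AddCommGroup N]
    [Module R N] {m : ℕ} (α : M [⋀^Fin (m + 2)]→ₗ[R] N) :
    M [⋀^Fin 2]→ₗ[R] (M [⋀^Fin m]→ₗ[R] N) where
  toFun v := (α.curryLeft (v 1)).curryLeft (v 0)
  map_update_add' := by
    intro dec v i a b
    have hdec : dec = instDecidableEqFin 2 := Subsingleton.elim _ _
    subst hdec
    fin_cases i <;> simp
  map_update_smul' := by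
    intro dec v i a b
    have hdec : dec = instDecidableEqFin 2 := Subsingleton.elim _ _
    subst hdec
    fin_cases i <;> simp
  map_eq_zero_of_eq' := by
    intro v i j hv hij
    have h : v 0 = v 1 := by
      fin_cases i <;> fin_cases j <;> first | exact absurd rfl hij | exact hv | exact hv.symm
    rw [h, AlternatingMap.curryLeft_same]

theorem contractPair_apply {R M N : Type*} [CommRing R] [AddCommGroup M] [Module R M]
    [AddCommGroup N] [Module R N] {m : ℕ} (α : M [⋀^Fin (m + 2)]→ₗ[R] N) (v : Fin 2 → M)
    (w : Fin m → M) :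
    contractPair α v w = α (Matrix.vecCons (v 1) (Matrix.vecCons (v 0) w)) := rfl

/-- Contraction of an alternating map with bivectors. -/
def contract {R M N : Type*} [CommRing R] [AddCommGroup M] [Module R M] [AddCommGroup N]
    [Module R N] {m : ℕ} (α : M [⋀^Fin (m + 2)]→ₗ[R] N) :
    ⋀[R]^2 M →ₗ[R] (M [⋀^Fin m]→ₗ[R] N) :=
  exteriorPower.alternatingMapLinearEquiv (contractPair α)

theorem contract_ιMulti {R M N : Type*} [CommRing R] [AddCommGroup M] [Module R M] [AddCommGroup N]
    [Module R N] {m : ℕ} (α : M [⋀^Fin (m + 2)]→ₗ[R] N) (v : Fin 2 → M) :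
    contract α (exteriorPower.ιMulti R 2 v) = contractPair α v :=
  exteriorPower.alternatingMapLinearEquiv_apply_ιMulti _ _

variable {K : Type*} [Field K]

theorem finrank_alternatingMap (E : Type*) [AddCommGroup E] [Module K E] [Module.Finite K E]
    (k : ℕ) : Module.finrank K (E [⋀^Fin k]→ₗ[K] K) = (Module.finrank K E).choose k := by
  rw [(exteriorPower.alternatingMapLinearEquiv (R := K) (M := E) (N := K) (n := k)).finrank_eq]
  exact (Subspace.dual_finrank_eq (K := K) (V := ⋀[K]^k E)).trans (exteriorPower.finrank_eq _ _)

theorem finite_alternatingMap (E : Type*) [AddCommGroup E] [Module K E] [Module.Finite K E]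
    (k : ℕ) : Module.Finite K (E [⋀^Fin k]→ₗ[K] K) :=
  Module.Finite.equiv
    (exteriorPower.alternatingMapLinearEquiv (R := K) (M := E) (N := K) (n := k)).symm

/-- Evaluating the contraction on the basis vectors complementary to a pair isolates the difference
of the two coefficients of that pair. So the coefficients are symmetric, whereas the wedge is
antisymmetric, and the bivector is zero. -/
theorem contract_injective [CharZero K] {m : ℕ} {E : Type*} [AddCommGroup E] [Module K E]
    (b : Module.Basis (Fin (m + 2)) K E) {α : E [⋀^Fin (m + 2)]→ₗ[K] K} (hα : α ≠ 0) :
    Function.Injective (contract α) := by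
  rw [injective_iff_map_eq_zero]
  intro β hβ
  have hαb : α b ≠ 0 := fun h => hα (Module.Basis.ext_alternating b fun v hv => by
    let σ := Equiv.ofBijective v (Finite.injective_iff_bijective.1 hv)
    have := α.map_perm b σ
    rw [AlternatingMap.zero_apply]
    change α (b ∘ σ) = 0
    rw [this, h, smul_zero])
  obtain ⟨c, rfl⟩ : ∃ c : (Fin 2 → Fin (m + 2)) → K,
      ∑ r, c r • exteriorPower.ιMulti K 2 (b ∘ r) = β := by
    rw [← Submodule.mem_span_range_iff_exists_fun]
    have h := exteriorPower.ιMulti_span_of_span K 2 E b.span_eq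
    have hβ' : β ∈ (⊤ : Submodule K (⋀[K]^2 E)) := trivial
    rw [← h] at hβ'
    refine Submodule.span_mono ?_ hβ'
    rintro _ ⟨v, hv, rfl⟩
    choose r hr using fun i => hv ⟨i, rfl⟩
    exact ⟨r, congrArg _ (funext hr)⟩
  have hsymm : ∀ r : Fin 2 → Fin (m + 2), r 0 ≠ r 1 → c r = c (r ∘ Equiv.swap 0 1) := by
    intro r hr
    -- The values of `σ` from index 2 on enumerate the complement of the pair `r`. The order at 0
    -- and 1 is reversed because the contraction inserts the second vector first.
    obtain ⟨σ, h0, h1⟩ : ∃ σ : Equiv.Perm (Fin (m + 2)), σ 0 = r 1 ∧ σ 1 = r 0 := by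
      have hne : (Equiv.swap 0 (r 1)) (r 0) ≠ 0 := by
        rw [Ne, Equiv.swap_apply_eq_iff, Equiv.swap_apply_left]
        exact hr
      refine ⟨Equiv.swap 0 (r 1) * Equiv.swap 1 (Equiv.swap 0 (r 1) (r 0)), ?_, ?_⟩
      · rw [Equiv.Perm.mul_apply, Equiv.swap_apply_of_ne_of_ne (by simp) hne.symm,
          Equiv.swap_apply_left]
      · rw [Equiv.Perm.mul_apply, Equiv.swap_apply_left, Equiv.swap_apply_self]
    have h := congrArg (fun f => f fun k => b (σ k.succ.succ)) hβ
    simp only [map_sum, map_smul, contract_ιMulti, alternatingMap_sum_apply,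
      AlternatingMap.smul_apply, contractPair_apply, Function.comp_apply,
      AlternatingMap.zero_apply] at h
    have hrs : r ≠ r ∘ Equiv.swap 0 1 := fun h => hr (by simpa using congrFun h 0)
    rw [Fintype.sum_eq_add r (r ∘ Equiv.swap 0 1) hrs] at h
    · have e1 : Matrix.vecCons (b (r 1)) (Matrix.vecCons (b (r 0)) fun k => b (σ k.succ.succ))
          = b ∘ σ := by
        funext l
        refine Fin.cases ?_ (fun l => Fin.cases ?_ (fun l => ?_) l) l <;> simp [h0, h1]
      have e2 : Matrix.vecCons (b (r 0)) (Matrix.vecCons (b (r 1)) fun k => b (σ k.succ.succ))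
          = (b ∘ σ) ∘ Equiv.swap 0 1 := by
        funext l
        refine Fin.cases ?_ (fun l => Fin.cases ?_ (fun l => ?_) l) l
        · simp [h1]
        · simp [h0]
        · rw [Function.comp_apply, Equiv.swap_apply_of_ne_of_ne (by simp)
            (by simp [Fin.ext_iff])]
          simp
      simp only [Function.comp_apply, Equiv.swap_apply_left, Equiv.swap_apply_right, e1, e2] at h
      rw [α.map_swap _ (by simp), smul_neg, ← sub_eq_add_neg, ← sub_smul, smul_eq_zero,
        sub_eq_zero] at h
      refine h.resolve_right ?_
      rw [α.map_perm]
      exact (smul_eq_zero_iff_eq _).not.2 hαb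
    · rintro s ⟨hs1, hs2⟩
      refine smul_eq_zero_of_right _ ?_
      -- Any other index pair repeats a basis vector in `α`, either within the pair or among the
      -- complementary vectors.
      have hσ : ∀ i, (∃ k : Fin m, s i = σ k.succ.succ) ∨ s i = r 1 ∨ s i = r 0 := by
        intro i
        rw [← σ.apply_symm_apply (s i)]
        generalize σ.symm (s i) = l
        refine Fin.cases ?_ (fun l => Fin.cases ?_ (fun l => ?_) l) l
        · exact Or.inr (Or.inl h0)
        · exact Or.inr (Or.inr h1)
        · exact Or.inl ⟨l, rfl⟩
      rcases hσ 0 with ⟨k, hk⟩ | hσ0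
      · exact α.map_eq_zero_of_eq _ (i := 1) (j := k.succ.succ) (by simp [hk])
          (by simp [Fin.ext_iff])
      rcases hσ 1 with ⟨k, hk⟩ | hσ1
      · exact α.map_eq_zero_of_eq _ (i := 0) (j := k.succ.succ) (by simp [hk])
          (by simp [Fin.ext_iff])
      by_cases h01 : s 0 = s 1
      · exact α.map_eq_zero_of_eq _ (i := 0) (j := 1) (by simp [h01]) (by simp)
      rcases hσ0 with a | a <;> rcases hσ1 with b | b
      · exact absurd (a.trans b.symm) h01
      · exact absurd (funext fun i => by fin_cases i <;> simp [a, b]) hs2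
      · exact absurd (funext fun i => by fin_cases i <;> simp [a, b]) hs1
      · exact absurd (a.trans b.symm) h01
  -- The sum is added to its own reindexing by the swap of the two slots, and the terms cancel in
  -- pairs.
  have hdouble : (2 : K) • ∑ r, c r • exteriorPower.ιMulti K 2 (b ∘ r) = 0 := by
    have hre : ∑ r, c r • exteriorPower.ιMulti K 2 (b ∘ r)
        = ∑ r : Fin 2 → Fin (m + 2), c (r ∘ Equiv.swap 0 1) •
          exteriorPower.ιMulti K 2 (b ∘ r ∘ Equiv.swap 0 1) :=
      (Equiv.sum_comp (Equiv.arrowCongr (Equiv.swap (0 : Fin 2) 1) (Equiv.refl (Fin (m + 2))))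
        fun r => c r • exteriorPower.ιMulti K 2 (b ∘ r)).symm
    rw [two_smul]
    nth_rewrite 2 [hre]
    rw [← sum_add_distrib]
    refine sum_eq_zero fun r _ => ?_
    rw [← Function.comp_assoc, (exteriorPower.ιMulti K 2).map_swap _ (by simp)]
    by_cases hr : r 0 = r 1
    · rw [(exteriorPower.ιMulti K 2).map_eq_zero_of_eq (b ∘ r) (i := 0) (j := 1)
        (by simp [hr]) (by simp)]
      simp
    · rw [← hsymm r hr, smul_neg, add_neg_cancel]
  exact (smul_eq_zero.1 hdouble).resolve_left two_ne_zero

/-- The dimensions agree: `(m+2).choose 2 = (m+2).choose m`. -/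
theorem contract_bijective [CharZero K] {m : ℕ} {E : Type*} [AddCommGroup E] [Module K E]
    (b : Module.Basis (Fin (m + 2)) K E) {α : E [⋀^Fin (m + 2)]→ₗ[K] K} (hα : α ≠ 0) :
    Function.Bijective (contract α) := by
  have : Module.Finite K E := Module.Finite.of_basis b
  have := finite_alternatingMap (K := K) E m
  have hi := contract_injective b hα
  refine ⟨hi, (LinearMap.injective_iff_surjective_of_finrank_eq_finrank ?_).1 hi⟩
  rw [finrank_alternatingMap, exteriorPower.finrank_eq, Module.finrank_eq_card_basis b,
    Fintype.card_fin, Nat.choose_symm_add]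

end Frames

/-! ### Contraction with the volume form on fibers -/

section PointwiseContraction

variable {A : Type*} [CommRing A] [Algebra ℂ A]

/-- Lifts a basis of the tangent space to global fields, so that questions at `x` become linear
algebra on `ℂⁿ`. -/
theorem exists_frame {n : ℕ} (x : A →ₐ[ℂ] ℂ)
    (hn : Module.finrank ℂ (Fiber x (VectorField A)) = n) (hpos : 0 < n) :
    ∃ L : (Fin n → ℂ) →ₗ[ℂ] VectorField A, ∀ ξ, ∃ a,
      ξ - L a ∈ (RingHom.ker x • ⊤ : Submodule A (VectorField A)) := by
  have : Module.Finite ℂ (Fiber x (VectorField A)) := Module.finite_of_finrank_pos (hn ▸ hpos)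
  let b := Module.finBasisOfFinrankEq ℂ (Fiber x (VectorField A)) hn
  choose e he using fun i => valueAt_surjective x (VectorField A) (b i)
  refine ⟨Fintype.linearCombination ℂ e, fun ξ => ⟨b.equivFun (valueAt x ξ), ?_⟩⟩
  rw [← Submodule.Quotient.eq]
  change valueAt x ξ = evalAt x _ (Fintype.linearCombination ℂ e (b.equivFun (valueAt x ξ)))
  rw [Fintype.linearCombination_apply, map_sum]
  conv_lhs => rw [← b.sum_equivFun (valueAt x ξ)]
  exact sum_congr rfl fun i _ => by rw [← he i, map_smul]; rfl

/-- An `A`-alternating map, regarded as a complex alternating map. -/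
def restrictAlternating {M N ι : Type*} [AddCommGroup M] [Module A M] [Module ℂ M]
    [IsScalarTower ℂ A M] [AddCommGroup N] [Module A N] [Module ℂ N] [IsScalarTower ℂ A N]
    (α : M [⋀^ι]→ₗ[A] N) : M [⋀^ι]→ₗ[ℂ] N where
  toMultilinearMap := α.toMultilinearMap.restrictScalars ℂ
  map_eq_zero_of_eq' v _ _ h hij := α.map_eq_zero_of_eq v h hij

theorem restrictAlternating_apply {M N ι : Type*} [AddCommGroup M] [Module A M] [Module ℂ M]
    [IsScalarTower ℂ A M] [AddCommGroup N] [Module A N] [Module ℂ N] [IsScalarTower ℂ A N]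
    (α : M [⋀^ι]→ₗ[A] N) (v : ι → M) : restrictAlternating α v = α v := rfl

variable {E : Type*} [AddCommGroup E] [Module ℂ E]

/-- The alternating form `a ↦ τ(L a₁, …, L a_k)(x)`. -/
def pullForm (x : A →ₐ[ℂ] ℂ) (L : E →ₗ[ℂ] VectorField A) (k : ℕ) :
    Form A k →ₗ[ℂ] (E [⋀^Fin k]→ₗ[ℂ] ℂ) where
  toFun τ := x.toLinearMap.compAlternatingMap ((restrictAlternating τ).compLinearMap L)
  map_add' σ τ := by ext a; simp [restrictAlternating_apply]
  map_smul' c τ := by ext a; simp [restrictAlternating_apply]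

theorem pullForm_apply (x : A →ₐ[ℂ] ℂ) (L : E →ₗ[ℂ] VectorField A) (k : ℕ) (τ : Form A k)
    (a : Fin k → E) : pullForm x L k τ a = x (τ fun i => L (a i)) := rfl

/-- The complex linear map of bivectors induced by `L`. -/
def pushBivector (L : E →ₗ[ℂ] VectorField A) : ⋀[ℂ]^2 E →ₗ[ℂ] Bivector A :=
  exteriorPower.alternatingMapLinearEquiv
    ((restrictAlternating (exteriorPower.ιMulti A 2)).compLinearMap L)

theorem pushBivector_ιMulti (L : E →ₗ[ℂ] VectorField A) (v : Fin 2 → E) :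
    pushBivector L (exteriorPower.ιMulti ℂ 2 v) = wedge (L (v 0)) (L (v 1)) := by
  rw [pushBivector, exteriorPower.alternatingMapLinearEquiv_apply_ιMulti]
  change exteriorPower.ιMulti A 2 _ = exteriorPower.ιMulti A 2 _
  congr 1
  ext i; fin_cases i <;> rfl

theorem contract_wedge {m : ℕ} (ω : Form A (m + 2)) (ξ η : VectorField A) :
    contract ω (wedge ξ η) = interior ξ (interior η ω) := contract_ιMulti ω _

theorem pullForm_contract_pushBivector {m : ℕ} (x : A →ₐ[ℂ] ℂ) (L : E →ₗ[ℂ] VectorField A)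
    (ω : Form A (m + 2)) (β : ⋀[ℂ]^2 E) :
    pullForm x L m (contract ω (pushBivector L β)) = contract (pullForm x L (m + 2) ω) β := by
  have h : (pullForm x L m ∘ₗ (contract ω).restrictScalars ℂ) ∘ₗ pushBivector L
      = contract (pullForm x L (m + 2) ω) := by
    refine exteriorPower.linearMap_ext (AlternatingMap.ext fun v => AlternatingMap.ext fun w => ?_)
    simp only [LinearMap.compAlternatingMap_apply, LinearMap.comp_apply,
      LinearMap.restrictScalars_apply, pushBivector_ιMulti, contract_wedge, contract_ιMulti,
      contractPair_apply, pullForm_apply, interior, AlternatingMap.curryLeft_apply_apply]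
    congr 2
    funext l
    refine Fin.cases ?_ (fun l => Fin.cases ?_ (fun l => ?_) l) l <;> simp
  exact congrArg (fun f => f β) h

section Frame

variable {x : A →ₐ[ℂ] ℂ} {L : E →ₗ[ℂ] VectorField A}
  (hL : ∀ ξ, ∃ a, ξ - L a ∈ (RingHom.ker x • ⊤ : Submodule A (VectorField A)))
include hL

/-- The arguments are exchanged one at a time for frame fields, which does not change the value at
`x`. -/
theorem apply_eq_zero_of_pullForm_eq_zero {k : ℕ} {τ : Form A k} (h : pullForm x L k τ = 0)
    (v : Fin k → VectorField A) : x (τ v) = 0 := by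
  classical
  choose a ha using fun i => hL (v i)
  have key : ∀ s : Finset (Fin k), x (τ (s.piecewise (fun i => L (a i)) v)) = x (τ v) := by
    intro s
    induction s using Finset.induction_on with
    | empty => simp
    | insert i s hi ih =>
      rw [Finset.piecewise_insert, ← ih, ← sub_eq_zero, ← map_sub]
      have h1 : s.piecewise (fun i => L (a i)) v
          = Function.update (s.piecewise (fun i => L (a i)) v) i (v i) := by
        rw [eq_comm, Function.update_eq_self_iff]
        simp [hi]
      nth_rewrite 2 [h1]
      rw [← AlternatingMap.map_update_sub]
      refine apply_eq_zero_of_field_mem_ker_smul_top x τ _ i ?_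
      rw [Function.update_self, ← neg_sub]
      exact neg_mem (ha i)
  rw [← key univ, Finset.piecewise_univ]
  exact congrArg (fun f => f a) h

theorem exists_sub_pushBivector_mem (B : Bivector A) :
    ∃ β, B - pushBivector L β ∈ (RingHom.ker x • ⊤ : Submodule A (Bivector A)) := by
  have hB : B ∈ (⊤ : Submodule A (Bivector A)) := trivial
  rw [← exteriorPower.ιMulti_span] at hB
  induction hB using Submodule.span_induction with
  | mem _ h =>
    obtain ⟨v, rfl⟩ := h
    choose a ha using fun i => hL (v i)
    refine ⟨exteriorPower.ιMulti ℂ 2 a, ?_⟩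
    have key : ∀ (i : Fin 2) (u : Fin 2 → VectorField A),
        u i ∈ (RingHom.ker x • ⊤ : Submodule A (VectorField A)) →
        exteriorPower.ιMulti A 2 u ∈ (RingHom.ker x • ⊤ : Submodule A (Bivector A)) := by
      intro i u hu
      rw [← Function.update_eq_self i u]
      generalize u i = z at hu
      induction hu using Submodule.smul_induction_on' with
      | smul b hb σ _ =>
        rw [AlternatingMap.map_update_smul]
        exact Submodule.smul_mem_smul hb trivial
      | add σ _ ρ _ h1 h2 => rw [AlternatingMap.map_update_add]; exact add_mem h1 h2
    rw [pushBivector_ιMulti]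
    have h1 := key 0 ![v 0 - L (a 0), v 1] (ha 0)
    have h2 := key 1 ![L (a 0), v 1 - L (a 1)] (ha 1)
    have e1 : exteriorPower.ιMulti A 2 ![v 0 - L (a 0), v 1]
        = exteriorPower.ιMulti A 2 v - wedge (L (a 0)) (v 1) := by
      have := (exteriorPower.ιMulti A 2).map_update_sub v 0 (v 0) (L (a 0))
      rw [Function.update_eq_self] at this
      rw [wedge]
      convert this using 2
      · funext i; fin_cases i <;> simp
      · congr 1; funext i; fin_cases i <;> simp
    have e2 : exteriorPower.ιMulti A 2 ![L (a 0), v 1 - L (a 1)]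
        = wedge (L (a 0)) (v 1) - wedge (L (a 0)) (L (a 1)) := by
      have := (exteriorPower.ιMulti A 2).map_update_sub ![L (a 0), v 1] 1 (v 1) (L (a 1))
      rw [wedge, wedge]
      convert this using 2
      · funext i; fin_cases i <;> simp
      · congr 1; funext i; fin_cases i <;> simp
      · congr 1; funext i; fin_cases i <;> simp
    rw [e1] at h1
    rw [e2] at h2
    simpa using add_mem h1 h2
  | zero => exact ⟨0, by simp⟩
  | add B C _ _ h1 h2 =>
    obtain ⟨β, hβ⟩ := h1
    obtain ⟨γ, hγ⟩ := h2
    exact ⟨β + γ, by simpa [add_sub_add_comm] using add_mem hβ hγ⟩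
  | smul b B _ h =>
    obtain ⟨β, hβ⟩ := h
    refine ⟨x b • β, ?_⟩
    have h1 := Submodule.smul_mem _ b hβ
    have h2 := smul_sub_smul_mem x b (pushBivector L β)
    simpa [smul_sub] using add_mem h1 h2

end Frame

theorem map_mem_ker_smul_top (x : A →ₐ[ℂ] ℂ) {M N : Type*} [AddCommGroup M] [Module A M]
    [AddCommGroup N] [Module A N] (f : M →ₗ[A] N) {s : M}
    (hs : s ∈ (RingHom.ker x • ⊤ : Submodule A M)) :
    f s ∈ (RingHom.ker x • ⊤ : Submodule A N) := by
  have := Submodule.mem_map_of_mem (f := f) hs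
  rw [Submodule.map_smul''] at this
  exact Submodule.smul_mono le_rfl le_top this

theorem pullForm_eq_zero_of_mem (x : A →ₐ[ℂ] ℂ) (L : E →ₗ[ℂ] VectorField A) {k : ℕ}
    {τ : Form A k} (h : τ ∈ (RingHom.ker x • ⊤ : Submodule A (Form A k))) :
    pullForm x L k τ = 0 :=
  AlternatingMap.ext fun _ => apply_eq_zero_of_mem_ker_smul_top x h _

variable [Algebra.Smooth ℂ A] {m : ℕ} {ω : Form A (m + 2)} (hω : IsVolumeForm ω)
include hω

theorem IsVolumeForm.exists_frame (x : A →ₐ[ℂ] ℂ) :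
    ∃ L : (Fin (m + 2) → ℂ) →ₗ[ℂ] VectorField A,
      (∀ ξ, ∃ a, ξ - L a ∈ (RingHom.ker x • ⊤ : Submodule A (VectorField A))) ∧
      Function.Bijective (contract (pullForm x L (m + 2) ω)) := by
  obtain ⟨L, hL⟩ := AffineVar.exists_frame x (hω.finrank_tangent x) (by omega)
  refine ⟨L, hL, contract_bijective (Pi.basisFun ℂ (Fin (m + 2))) fun h => ?_⟩
  exact hω.ne_zero x ((valueAt_eq_zero_iff x ω).2
    (form_mem_ker_smul_top x (apply_eq_zero_of_pullForm_eq_zero hL h)))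

/-- More vectors than the dimension are linearly dependent in each tangent space, and a function on
a reduced variety is determined by its values. -/
theorem IsVolumeForm.form_eq_zero [IsReduced A] {k : ℕ} (hk : m + 2 < k) (τ : Form A k) :
    τ = 0 := by
  ext v
  refine eq_zero_of_forall_point fun x => ?_
  obtain ⟨L, hL, -⟩ := hω.exists_frame x
  refine apply_eq_zero_of_pullForm_eq_zero hL (AlternatingMap.ext fun a => ?_) v
  refine AlternatingMap.map_linearDependent _ _ fun hli => ?_
  have := hli.fintype_card_le_finrank
  simp at this
  omega

theorem IsVolumeForm.mem_of_contract_mem (x : A →ₐ[ℂ] ℂ) {B : Bivector A}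
    (h : contract ω B ∈ (RingHom.ker x • ⊤ : Submodule A (Form A m))) :
    B ∈ (RingHom.ker x • ⊤ : Submodule A (Bivector A)) := by
  obtain ⟨L, hL, hbij⟩ := hω.exists_frame x
  obtain ⟨β, hβ⟩ := exists_sub_pushBivector_mem hL B
  have h1 := sub_mem h (map_mem_ker_smul_top x (contract ω) hβ)
  rw [← map_sub, sub_sub_cancel] at h1
  have h2 := pullForm_eq_zero_of_mem x L h1
  rw [pullForm_contract_pushBivector, map_eq_zero_iff _ hbij.1] at h2
  simpa [h2] using hβ

theorem IsVolumeForm.exists_pullForm_contract (x : A →ₐ[ℂ] ℂ) :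
    ∃ L : (Fin (m + 2) → ℂ) →ₗ[ℂ] VectorField A,
      (∀ τ : Form A m, pullForm x L m τ = 0 ↔ valueAt x τ = 0) ∧
      ∀ α, ∃ B, pullForm x L m (contract ω B) = α := by
  obtain ⟨L, hL, hbij⟩ := hω.exists_frame x
  refine ⟨L, fun τ => ⟨fun h => (valueAt_eq_zero_iff x τ).2
    (form_mem_ker_smul_top x (apply_eq_zero_of_pullForm_eq_zero hL h)), fun h =>
    pullForm_eq_zero_of_mem x L ((valueAt_eq_zero_iff x τ).1 h)⟩, fun α => ?_⟩
  obtain ⟨β, hβ⟩ := hbij.2 α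
  exact ⟨pushBivector L β, by rw [pullForm_contract_pushBivector, hβ]⟩

theorem IsVolumeForm.exists_valueAt_contract (x : A →ₐ[ℂ] ℂ) (τ : Form A m) :
    ∃ B, valueAt x (contract ω B) = valueAt x τ := by
  obtain ⟨L, hL, hs⟩ := hω.exists_pullForm_contract x
  obtain ⟨B, hB⟩ := hs (pullForm x L m τ)
  refine ⟨B, ?_⟩
  rw [← sub_eq_zero, ← map_sub, hL] at hB
  exact sub_eq_zero.1 hB

/-- What matters is that the right-hand side does not depend on `x`: the forms have fibers of
constant dimension. -/
theorem IsVolumeForm.finrank_fiber_form (x : A →ₐ[ℂ] ℂ) :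
    Module.finrank ℂ (Fiber x (Form A m))
      = Module.finrank ℂ ((Fin (m + 2) → ℂ) [⋀^Fin m]→ₗ[ℂ] ℂ) := by
  obtain ⟨L, hL, hs⟩ := hω.exists_pullForm_contract x
  have hker : LinearMap.ker (evalAt x (Form A m)) = LinearMap.ker (pullForm x L m) := by
    ext τ
    exact (hL τ).symm
  exact (((evalAt x (Form A m)).quotKerEquivOfSurjective (valueAt_surjective x _)).symm.trans
    ((Submodule.quotEquivOfEq _ _ hker).trans ((pullForm x L m).quotKerEquivOfSurjective
      fun α => let ⟨B, hB⟩ := hs α; ⟨contract ω B, hB⟩))).finrank_eq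

end PointwiseContraction

/-! ### Submodules whose values have constant rank -/

section ConstantRank

variable {A : Type*} [CommRing A] [Algebra ℂ A]
  {F : Type*} [AddCommGroup F] [Module A F] [Module ℂ F] [IsScalarTower ℂ A F]

/-- The values at `x` of the sections in `N`. -/
def valuesAt (x : A →ₐ[ℂ] ℂ) (N : Submodule A F) : Submodule ℂ (Fiber x F) :=
  (N.restrictScalars ℂ).map (evalAt x F)

theorem finite_fiber [Module.Finite A F] (x : A →ₐ[ℂ] ℂ) : Module.Finite ℂ (Fiber x F) := by
  obtain ⟨s, hs⟩ := Module.finite_def.1 ‹Module.Finite A F›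
  classical
  refine Module.finite_def.2 ⟨s.image (valueAt x), eq_top_iff.2 fun t _ => ?_⟩
  obtain ⟨t, rfl⟩ := valueAt_surjective x F t
  have ht : t ∈ Submodule.span A (s : Set F) := hs ▸ trivial
  induction ht using Submodule.span_induction with
  | mem t h => exact Submodule.subset_span (by simpa using ⟨t, h, rfl⟩)
  | zero => exact zero_mem _
  | add _ _ _ _ h1 h2 => exact add_mem (h1 trivial) (h2 trivial)
  | smul a t _ h => rw [valueAt_smul]; exact Submodule.smul_mem _ _ (h trivial)

/-- Nakayama's lemma: sections that generate the fiber generate the module near `x`. -/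
theorem exists_smul_mem_span_of_values_span [Module.Finite A F] (x : A →ₐ[ℂ] ℂ) {ι : Type*}
    [Fintype ι] (u : ι → F) (hu : Submodule.span ℂ (Set.range fun i => valueAt x (u i)) = ⊤) :
    ∃ a : A, x a ≠ 0 ∧ ∀ t, a • t ∈ Submodule.span A (Set.range u) := by
  obtain ⟨a, ha, hle⟩ := Submodule.exists_sub_one_mem_and_smul_le_of_fg_of_le_sup
    (I := RingHom.ker x) (N := Submodule.span A (Set.range u)) (N' := (⊤ : Submodule A F))
    (P := ⊤) Module.Finite.fg_top le_rfl (fun t _ => by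
      have ht : valueAt x t ∈ Submodule.span ℂ (Set.range fun i => valueAt x (u i)) :=
        hu ▸ trivial
      obtain ⟨c, hc⟩ := (Submodule.mem_span_range_iff_exists_fun ℂ).1 ht
      have hmem : ∑ i, algebraMap ℂ A (c i) • u i ∈ Submodule.span A (Set.range u) :=
        sum_mem fun i _ => Submodule.smul_mem _ _ (Submodule.subset_span ⟨i, rfl⟩)
      have hdiff : t - ∑ i, algebraMap ℂ A (c i) • u i
          ∈ (RingHom.ker x • ⊤ : Submodule A F) := by
        rw [← Submodule.Quotient.eq]
        change evalAt x F t = evalAt x F _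
        simp only [algebraMap_smul, map_sum, map_smul]
        exact hc.symm
      exact Submodule.mem_sup.2 ⟨_, hmem, _, hdiff, by abel⟩)
  refine ⟨a, ?_, fun t => hle (Submodule.smul_mem_pointwise_smul t a ⊤ trivial)⟩
  rw [RingHom.mem_ker, map_sub, map_one, sub_eq_zero] at ha
  rw [ha]
  exact one_ne_zero

/-- Sections `w` of `N` giving a basis of its values at `x₀` are completed by sections `f` to a
frame of `F` near `x₀`. By constant rank, `w` still spans the values of `N` nearby, so the
`f`-coefficients of `t` vanish at all nearby points, hence vanish locally because `A` is reduced. -/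
theorem exists_smul_mem_of_forall_value_mem [Algebra.FiniteType ℂ A] [IsReduced A]
    [Module.Finite A F] {D : ℕ} (hD : ∀ x : A →ₐ[ℂ] ℂ, Module.finrank ℂ (Fiber x F) = D)
    {N : Submodule A F} {t : F} (ht : ∀ x : A →ₐ[ℂ] ℂ, valueAt x t ∈ valuesAt x N)
    (x₀ : A →ₐ[ℂ] ℂ) {g : A} (hg : x₀ g ≠ 0) {r : ℕ}
    (hr : ∀ x : A →ₐ[ℂ] ℂ, x g ≠ 0 → Module.finrank ℂ (valuesAt x N) = r) :
    ∃ a : A, x₀ a ≠ 0 ∧ a • t ∈ N := by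
  have hfin := fun x => finite_fiber (F := F) (A := A) x
  obtain ⟨W', hW'⟩ := Submodule.exists_isCompl (valuesAt x₀ N)
  let b := Module.finBasisOfFinrankEq ℂ (valuesAt x₀ N) (hr x₀ hg)
  let b' := Module.finBasis ℂ W'
  have hcard : r + Module.finrank ℂ W' = D := by
    rw [← hr x₀ hg, Submodule.finrank_add_eq_of_isCompl hW', hD]
  choose w hwN hw using fun i => (b i).2
  choose f hf using fun i => valueAt_surjective x₀ F (b' i)
  let u : Fin r ⊕ Fin (Module.finrank ℂ W') → F := Sum.elim w f
  have hrange : ∀ x : A →ₐ[ℂ] ℂ, (Set.range fun i => valueAt x (u i))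
      = (Set.range fun i => valueAt x (w i)) ∪ Set.range fun i => valueAt x (f i) := by
    intro x
    rw [← Set.Sum.elim_range]
    congr 1
    funext i
    cases i <;> rfl
  have hspan : Submodule.span ℂ (Set.range fun i => valueAt x₀ (u i)) = ⊤ := by
    rw [hrange, Submodule.span_union, eq_top_iff, ← hW'.sup_eq_top]
    refine sup_le_sup ?_ ?_
    · have h1 : (fun i => valueAt x₀ (w i)) = fun i => ((b i : valuesAt x₀ N) : Fiber x₀ F) :=
        funext hw
      have h2 := congrArg (Submodule.map (valuesAt x₀ N).subtype) b.span_eq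
      rw [Submodule.map_span, ← Set.range_comp, Submodule.map_top, Submodule.range_subtype] at h2
      rw [h1]
      exact h2.ge
    · have h1 : (fun i => valueAt x₀ (f i)) = fun i => ((b' i : W') : Fiber x₀ F) :=
        funext hf
      have h2 := congrArg (Submodule.map W'.subtype) b'.span_eq
      rw [Submodule.map_span, ← Set.range_comp, Submodule.map_top, Submodule.range_subtype] at h2
      rw [h1]
      exact h2.ge
  obtain ⟨a, ha, hau⟩ := exists_smul_mem_span_of_values_span x₀ u hspan
  have hspan' : ∀ x : A →ₐ[ℂ] ℂ, x a ≠ 0 →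
      Submodule.span ℂ (Set.range fun i => valueAt x (u i)) = ⊤ := by
    intro x hx
    refine eq_top_iff.2 fun s _ => ?_
    obtain ⟨s, rfl⟩ := valueAt_surjective x F s
    obtain ⟨c, hc⟩ := (Submodule.mem_span_range_iff_exists_fun A).1 (hau s)
    have h1 : x a • valueAt x s = ∑ i, x (c i) • valueAt x (u i) := by
      rw [← valueAt_smul, ← hc]
      simp only [← valueAt_smul]
      exact map_sum (evalAt x F) _ _
    have h2 : valueAt x s = (x a)⁻¹ • ∑ i, x (c i) • valueAt x (u i) := by
      rw [← h1, smul_smul, inv_mul_cancel₀ hx, one_smul]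
    rw [h2]
    exact Submodule.smul_mem _ _ (sum_mem fun i _ =>
      Submodule.smul_mem _ _ (Submodule.subset_span ⟨i, rfl⟩))
  have hli : ∀ x : A →ₐ[ℂ] ℂ, x a ≠ 0 → LinearIndependent ℂ fun i => valueAt x (u i) :=
    fun x hx => linearIndependent_of_top_le_span_of_card_eq_finrank (hspan' x hx).ge
      (by rw [hD x, Fintype.card_sum, Fintype.card_fin, Fintype.card_fin, hcard])
  have hval : ∀ x : A →ₐ[ℂ] ℂ, x a ≠ 0 → x g ≠ 0 →
      Submodule.span ℂ (Set.range fun i => valueAt x (w i)) = valuesAt x N := by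
    intro x hxa hxg
    refine Submodule.eq_of_le_of_finrank_eq ?_ ?_
    · rw [Submodule.span_le]
      rintro _ ⟨i, rfl⟩
      exact ⟨w i, hwN i, rfl⟩
    · have h : LinearIndependent ℂ fun i => valueAt x (w i) :=
        (hli x hxa).comp Sum.inl Sum.inl_injective
      rw [hr x hxg, finrank_span_eq_card h, Fintype.card_fin]
  obtain ⟨c, hc⟩ := (Submodule.mem_span_range_iff_exists_fun A).1 (hau t)
  have hzero : ∀ j, g * a * c (Sum.inr j) = 0 := by
    intro j
    refine eq_zero_of_forall_point fun x => ?_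
    rw [map_mul, map_mul]
    by_cases hxa : x a = 0
    · rw [hxa, mul_zero, zero_mul]
    by_cases hxg : x g = 0
    · rw [hxg, zero_mul, zero_mul]
    refine mul_eq_zero_of_right _ ?_
    have h1 : x a • valueAt x t ∈ Submodule.span ℂ (Set.range fun i => valueAt x (w i)) := by
      rw [hval x hxa hxg]
      exact Submodule.smul_mem _ _ (ht x)
    obtain ⟨d, hd⟩ := (Submodule.mem_span_range_iff_exists_fun ℂ).1 h1
    have h2 : x a • valueAt x t = ∑ i, x (c i) • valueAt x (u i) := by
      rw [← valueAt_smul, ← hc]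
      simp only [← valueAt_smul]
      exact map_sum (evalAt x F) _ _
    have h3 : ∑ i, (x (c i) - Sum.elim d 0 i) • valueAt x (u i) = 0 := by
      simp only [sub_smul, sum_sub_distrib, ← h2, ← hd, Fintype.sum_sum_type]
      simp [u]
    simpa using Fintype.linearIndependent_iff.1 (hli x hxa) _ h3 (Sum.inr j)
  -- One factor `a` expands `t` in the frame; the remaining `g * a` kills the coefficients outside
  -- `N`.
  refine ⟨g * a * a, by simp [hg, ha], ?_⟩
  rw [mul_smul, ← hc, Fintype.sum_sum_type, smul_add, smul_sum, smul_sum]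
  refine add_mem (sum_mem fun i _ => ?_) (sum_mem fun j _ => ?_)
  · exact Submodule.smul_mem _ _ (Submodule.smul_mem _ _ (hwN i))
  · rw [smul_smul, hzero, zero_smul]
    exact zero_mem _

end ConstantRank

/-! ### From pointwise to global membership for the dual of a subbundle -/

section Subbundle

variable {A : Type*} [CommRing A] [Algebra ℂ A]
  {m : ℕ} {ω : Form A (m + 2)}

/-- The contraction with `ω` on the fibers over `x`. -/
def contractFiber (x : A →ₐ[ℂ] ℂ) (ω : Form A (m + 2)) :
    Fiber x (Bivector A) →ₗ[ℂ] Fiber x (Form A m) where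
  toFun := Submodule.mapQ (RingHom.ker x • ⊤) (RingHom.ker x • ⊤) (contract ω) fun _ hs =>
    map_mem_ker_smul_top x (contract ω) hs
  map_add' := map_add _
  map_smul' c s := by
    obtain ⟨B, rfl⟩ := valueAt_surjective x _ s
    change valueAt x (contract ω (c • B)) = valueAt x (c • contract ω B)
    rw [← algebraMap_smul A c B, map_smul, algebraMap_smul]

theorem contractFiber_valueAt (x : A →ₐ[ℂ] ℂ) (ω : Form A (m + 2)) (B : Bivector A) :
    contractFiber x ω (valueAt x B) = valueAt x (contract ω B) := rfl

theorem IsVolumeForm.contractFiber_injective [Algebra.Smooth ℂ A] (hω : IsVolumeForm ω) (x : A →ₐ[ℂ] ℂ) :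
    Function.Injective (contractFiber x ω) := by
  rw [injective_iff_map_eq_zero]
  intro s hs
  obtain ⟨B, rfl⟩ := valueAt_surjective x _ s
  rw [contractFiber_valueAt, valueAt_eq_zero_iff] at hs
  exact (valueAt_eq_zero_iff x B).2 (hω.mem_of_contract_mem x hs)

/-- A form with values in the dual of a subbundle spanned pointwise by given bivector fields is a
combination of the contractions of these. -/
theorem IsVolumeForm.mem_span_contract [Algebra.Smooth ℂ A] [IsReduced A] (hω : IsVolumeForm ω)
    {V : ∀ x : A →ₐ[ℂ] ℂ, Submodule ℂ (Fiber x (Bivector A))} (hV : IsSubbundle V)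
    {S : Set (Bivector A)} (hS : ∀ x, Submodule.span ℂ (valueAt x '' S) = V x)
    {τ : Form A m} (hτ : ∀ x : A →ₐ[ℂ] ℂ,
      valueAt x τ ∈ Submodule.span ℂ {θ : Fiber x (Form A m) | ∃ ξ η : VectorField A,
        valueAt x (wedge ξ η) ∈ V x ∧ θ = valueAt x (interior ξ (interior η ω))}) :
    τ ∈ Submodule.span A (contract ω '' S) := by
  have := finite_form (A := A) m
  have hW : ∀ x, valuesAt x (Submodule.span A (contract ω '' S))
      = (V x).map (contractFiber x ω) := by
    intro x
    refine le_antisymm ?_ ?_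
    · rintro _ ⟨σ, hσ, rfl⟩
      change σ ∈ Submodule.span A (contract ω '' S) at hσ
      change valueAt x σ ∈ _
      induction hσ using Submodule.span_induction with
      | mem _ h =>
        obtain ⟨B, hB, rfl⟩ := h
        exact ⟨valueAt x B, hS x ▸ Submodule.subset_span ⟨B, hB, rfl⟩, rfl⟩
      | zero => exact zero_mem _
      | add _ _ _ _ h1 h2 => exact add_mem h1 h2
      | smul a _ _ h => rw [valueAt_smul]; exact Submodule.smul_mem _ _ h
    · rw [← hS x, Submodule.map_span, Submodule.span_le]
      rintro _ ⟨_, ⟨B, hB, rfl⟩, rfl⟩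
      exact ⟨contract ω B, Submodule.subset_span ⟨B, hB, rfl⟩, rfl⟩
  refine mem_of_forall_point _ _ fun x₀ => ?_
  obtain ⟨g, hg, r, s, hs⟩ := hV x₀
  refine exists_smul_mem_of_forall_value_mem hω.finrank_fiber_form (fun x => ?_) x₀ hg (r := r)
    fun x hx => ?_
  · rw [hW]
    refine Submodule.span_le.2 ?_ (hτ x)
    rintro _ ⟨ξ, η, h, rfl⟩
    exact ⟨_, h, by rw [contractFiber_valueAt, contract_wedge]⟩
  · rw [hW, ← (Submodule.equivMapOfInjective _ (hω.contractFiber_injective x) (V x)).finrank_eq, ← (hs x hx).2,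
      finrank_span_eq_card (hs x hx).1, Fintype.card_fin]

end Subbundle

/-! ### Divergence-free fields and their brackets -/

section DivergenceFree

variable {A : Type*} [CommRing A] [IsReduced A] [Algebra ℂ A] [Algebra.Smooth ℂ A]
  {m : ℕ} {ω : Form A (m + 2)}

theorem IsVolumeForm.extDeriv_eq_zero (hω : IsVolumeForm ω) : extDeriv ω = 0 :=
  hω.form_eq_zero (Nat.lt_succ_self _) _

/-- Since `dω = 0` for degree reasons, `L_ξ ω = d (ι_ξ ω)`, and exact forms are closed. -/
theorem IsVolumeForm.isDivergenceFree_of_exact (hω : IsVolumeForm ω) {ξ : VectorField A}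
    (h : interior ξ ω ∈ exactForms A m) : IsDivergenceFree ω ξ := by
  obtain ⟨σ, hσ⟩ := h
  have h1 := interior_extDeriv ξ ω
  rw [hω.extDeriv_eq_zero, ← hσ, extDeriv_extDeriv, sub_zero] at h1
  exact h1.symm

/-- Contracting `df ∧ ω = 0` with `ξ` gives `df ∧ ι_ξ ω = ξ(f) ω = 0`, the only extra term in
`L_{fξ} ω`. -/
theorem IsVolumeForm.isDivergenceFree_smul (hω : IsVolumeForm ω) {ξ : VectorField A}
    (h : IsDivergenceFree ω ξ) {f : A} (hf : ξ f = 0) : IsDivergenceFree ω (f • ξ) := by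
  have h1 := interior_dWedge f ω ξ
  rw [hω.form_eq_zero (Nat.lt_succ_self _) (dWedge f ω), hf, zero_smul, zero_sub] at h1
  rw [IsDivergenceFree, lieDeriv_smul_field, show lieDeriv ξ ω = 0 from h, smul_zero, zero_add]
  exact neg_eq_zero.1 h1.symm

/-- As `L_ξ ω = 0`, the bracket contracts to `L_ξ (ι_η ω)`; as `ι_η ω` is closed, Cartan's formula
leaves only `d (ι_ξ ι_η ω)`. -/
theorem IsVolumeForm.interior_lie (hω : IsVolumeForm ω) {ξ η : VectorField A}
    (hξ : IsDivergenceFree ω ξ) (hη : IsDivergenceFree ω η) :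
    interior ⁅ξ, η⁆ ω = extDeriv (interior ξ (interior η ω)) := by
  have h1 := interior_lieDeriv ξ η ω
  have h2 := interior_extDeriv ξ (interior η ω)
  have h3 := interior_extDeriv η ω
  rw [show lieDeriv ξ ω = 0 from hξ] at h1
  rw [hω.extDeriv_eq_zero, show lieDeriv η ω = 0 from hη, zero_sub] at h3
  rw [neg_eq_zero.1 h3.symm] at h2
  have h4 : lieDeriv ξ (interior η ω) = interior ⁅ξ, η⁆ ω := (sub_eq_zero.1 h1.symm)
  rw [← h4]
  exact sub_eq_zero.1 h2.symm

end DivergenceFree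

/-- The function `f` is constant along integral curves of `ξ`, so rescaling time by the constant
`f(x)` gives an integral curve of `f ξ`. -/
theorem IsCompletelyIntegrable.smul {A : Type*} [CommRing A] [Algebra ℂ A] {ξ : VectorField A}
    (h : IsCompletelyIntegrable ξ) {f : A} (hf : ξ f = 0) : IsCompletelyIntegrable (f • ξ) := by
  intro x
  obtain ⟨φ, h0, hφ⟩ := h x
  have hconst : ∀ t, φ t f = x f := by
    intro t
    have hd : ∀ s, HasDerivAt (fun s => φ s f) 0 s := fun s => by simpa [hf] using hφ f s
    rw [← h0]
    exact is_const_of_deriv_eq_zero (fun s => (hd s).differentiableAt) (fun s => (hd s).deriv) t 0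
  refine ⟨fun s => φ (x f * s), by simp [h0], fun a t => ?_⟩
  have h1 := (hφ a (x f * t)).comp t ((hasDerivAt_id t).const_mul (x f))
  simpa [Function.comp_def, hconst, mul_comm] using h1

/-! ### Equivariance of the calculus and averaging over the group -/

section GroupAction

variable {A : Type*} [CommRing A] [Algebra ℂ A]
  {Γ : Type*} [Group Γ] [MulSemiringAction Γ A] [SMulCommClass Γ ℂ A]

theorem transport_apply (γ : Γ) (ξ : VectorField A) (f : A) :
    transport γ ξ f = γ • ξ (γ⁻¹ • f) := rfl

theorem transport_transport (γ δ : Γ) (ξ : VectorField A) :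
    transport γ (transport δ ξ) = transport (γ * δ) ξ := by
  ext f
  simp [transport_apply, mul_smul]

theorem transport_one (ξ : VectorField A) : transport (1 : Γ) ξ = ξ := by
  ext f
  simp [transport_apply]

theorem transport_lie (γ : Γ) (ξ η : VectorField A) :
    transport γ ⁅ξ, η⁆ = ⁅transport γ ξ, transport γ η⁆ := by
  ext f
  simp [transport_apply, Derivation.commutator_apply, smul_sub]

theorem IsInvariantField.transport_eq {ξ : VectorField A} (h : IsInvariantField Γ ξ) (γ : Γ) :
    transport γ ξ = ξ := by
  ext f
  rw [transport_apply, h, smul_inv_smul]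

theorem IsInvariantField.smul {ξ : VectorField A} (h : IsInvariantField Γ ξ)
    (f : Invariants Γ A) : IsInvariantField Γ ((f : A) • ξ) := by
  intro γ a
  have hf : γ • (f : A) = f := f.2 γ
  simp only [Derivation.coe_smul, Pi.smul_apply, smul_eq_mul, smul_mul', h γ a, hf]

theorem formAction_apply {k : ℕ} (γ : Γ) (τ : Form A k) (v : Fin k → VectorField A) :
    formAction γ τ v = γ • τ fun i => transport γ⁻¹ (v i) := rfl

theorem formAction_add {k : ℕ} (γ : Γ) (σ τ : Form A k) :
    formAction γ (σ + τ) = formAction γ σ + formAction γ τ := by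
  ext v
  simp [formAction_apply]

theorem formAction_sub {k : ℕ} (γ : Γ) (σ τ : Form A k) :
    formAction γ (σ - τ) = formAction γ σ - formAction γ τ := by
  rw [eq_sub_iff_add_eq, ← formAction_add, sub_add_cancel]

theorem formAction_zero {k : ℕ} (γ : Γ) : formAction γ (0 : Form A k) = 0 := by
  ext v
  simp [formAction_apply]

theorem formAction_sum {k : ℕ} {ι : Type*} (s : Finset ι) (γ : Γ) (τ : ι → Form A k) :
    formAction γ (∑ i ∈ s, τ i) = ∑ i ∈ s, formAction γ (τ i) :=
  map_sum (AddMonoidHom.mk' (formAction γ) (formAction_add γ)) τ s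

theorem formAction_smul {k : ℕ} (γ : Γ) (a : A) (τ : Form A k) :
    formAction γ (a • τ) = (γ • a) • formAction γ τ := by
  ext v
  simp [formAction_apply]

theorem formAction_smul_complex {k : ℕ} (γ : Γ) (c : ℂ) (τ : Form A k) :
    formAction γ (c • τ) = c • formAction γ τ := by
  ext v
  simp [formAction_apply, smul_comm]

theorem formAction_formAction {k : ℕ} (γ δ : Γ) (τ : Form A k) :
    formAction γ (formAction δ τ) = formAction (γ * δ) τ := by
  ext v
  simp [formAction_apply, transport_transport, mul_smul]

theorem formAction_interior {k : ℕ} (γ : Γ) (ξ : VectorField A) (τ : Form A (k + 1)) :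
    formAction γ (interior ξ τ) = interior (transport γ ξ) (formAction γ τ) := by
  ext v
  simp only [interior, formAction_apply, AlternatingMap.curryLeft_apply_apply]
  congr 2
  funext i
  refine Fin.cases ?_ (fun i => ?_) i <;> simp [transport_transport, transport_one]

theorem formAction_lieDeriv {k : ℕ} (γ : Γ) (ξ : VectorField A) (τ : Form A k) :
    formAction γ (lieDeriv ξ τ) = lieDeriv (transport γ ξ) (formAction γ τ) := by
  ext v
  simp only [formAction_apply, lieDeriv_apply, transport_apply, inv_smul_smul, smul_sub, smul_sum]
  congr 1
  refine sum_congr rfl fun i _ => ?_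
  congr 2
  funext l
  rw [Function.apply_update (fun _ => transport γ⁻¹) v i, transport_lie, transport_transport,
    inv_mul_cancel, transport_one]

/-- Every test field is a transported one, so Cartan's formula reduces the claim to the equivariance
of contraction and Lie derivative. -/
theorem formAction_extDeriv {k : ℕ} (γ : Γ) (τ : Form A k) :
    formAction γ (extDeriv τ) = extDeriv (formAction γ τ) := by
  have htr : ∀ ξ : VectorField A, ∃ ζ, transport γ ζ = ξ := fun ξ =>
    ⟨transport γ⁻¹ ξ, by rw [transport_transport, mul_inv_cancel, transport_one]⟩
  induction k with
  | zero =>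
    refine form_ext fun ξ => ?_
    obtain ⟨ζ, rfl⟩ := htr ξ
    rw [← formAction_interior, interior_extDeriv_zero, interior_extDeriv_zero, formAction_lieDeriv]
  | succ k ih =>
    refine form_ext fun ξ => ?_
    obtain ⟨ζ, rfl⟩ := htr ξ
    rw [← formAction_interior, interior_extDeriv, interior_extDeriv, formAction_sub,
      formAction_lieDeriv, ih, formAction_interior]

theorem formAction_interior_of_invariant {k : ℕ} {ξ : VectorField A} (h : IsInvariantField Γ ξ)
    (γ : Γ) (τ : Form A (k + 1)) :
    formAction γ (interior ξ τ) = interior ξ (formAction γ τ) := by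
  rw [formAction_interior, h.transport_eq]

variable [Fintype Γ]

variable (Γ) in
/-- The average of a function over the group. -/
def averageFun (a : A) : Invariants Γ A :=
  ⟨(Fintype.card Γ : ℂ)⁻¹ • ∑ γ : Γ, γ • a, fun δ => by
    rw [smul_comm, smul_sum]
    congr 1
    exact Fintype.sum_equiv (Equiv.mulLeft δ) _ _ fun γ => by rw [smul_smul, Equiv.coe_mulLeft]⟩

/-- The projection of `k`-forms onto the quasi-invariant ones for the character `χ`. -/
def quasiAverage (χ : Γ →* ℂˣ) {k : ℕ} (τ : Form A k) : Form A k :=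
  (Fintype.card Γ : ℂ)⁻¹ • ∑ γ : Γ, ((χ γ)⁻¹ : ℂ) • formAction γ τ

theorem quasiAverage_mem (χ : Γ →* ℂˣ) {k : ℕ} (τ : Form A k) :
    quasiAverage χ τ ∈ quasiInvariantForms A χ k := by
  intro δ
  rw [quasiAverage, formAction_smul_complex, smul_comm _ (Fintype.card Γ : ℂ)⁻¹, formAction_sum]
  refine congrArg _ ?_
  rw [smul_sum]
  refine Fintype.sum_equiv (Equiv.mulLeft δ) _ _ fun γ => ?_
  rw [formAction_smul_complex, formAction_formAction, Equiv.coe_mulLeft, smul_smul]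
  congr 1
  simp
  field_simp

theorem quasiAverage_of_mem (χ : Γ →* ℂˣ) {k : ℕ} {τ : Form A k}
    (h : τ ∈ quasiInvariantForms A χ k) : quasiAverage χ τ = τ := by
  have h1 : ∀ γ : Γ, ((χ γ)⁻¹ : ℂ) • formAction γ τ = τ := fun γ => by
    rw [h γ, smul_smul, inv_mul_cancel₀ (χ γ).ne_zero, one_smul]
  rw [quasiAverage, sum_congr rfl fun γ _ => h1 γ, sum_const, card_univ, ← Nat.cast_smul_eq_nsmul ℂ,
    smul_smul, inv_mul_cancel₀ (Nat.cast_ne_zero.2 Fintype.card_ne_zero), one_smul]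

theorem quasiAverage_extDeriv (χ : Γ →* ℂˣ) {k : ℕ} (τ : Form A k) :
    quasiAverage χ (extDeriv τ) = extDeriv (quasiAverage χ τ) := by
  simp only [quasiAverage, map_smul, map_sum, formAction_extDeriv]

theorem quasiAverage_add (χ : Γ →* ℂˣ) {k : ℕ} (σ τ : Form A k) :
    quasiAverage χ (σ + τ) = quasiAverage χ σ + quasiAverage χ τ := by
  simp only [quasiAverage, formAction_add, smul_add, sum_add_distrib]

theorem quasiAverage_zero (χ : Γ →* ℂˣ) {k : ℕ} : quasiAverage χ (0 : Form A k) = 0 := by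
  simp only [quasiAverage, formAction_zero, smul_zero, sum_const_zero]

/-- The weights `χ⁻¹` cancel the character of `τ`, so only the coefficient is averaged. -/
theorem quasiAverage_smul (χ : Γ →* ℂˣ) {k : ℕ} (a : A) {τ : Form A k}
    (h : τ ∈ quasiInvariantForms A χ k) :
    quasiAverage χ (a • τ) = (averageFun Γ a : A) • τ := by
  have h1 : ∀ γ : Γ, ((χ γ)⁻¹ : ℂ) • formAction γ (a • τ) = (γ • a) • τ := fun γ => by
    rw [formAction_smul, h γ, smul_comm, smul_smul, inv_mul_cancel₀ (χ γ).ne_zero, one_smul]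
  rw [quasiAverage, sum_congr rfl fun γ _ => h1 γ, ← sum_smul, averageFun, smul_assoc]

end GroupAction

/-! ### Forms produced by the Lie algebra -/

section LieAlgebra

variable {A : Type*} [CommRing A] [Algebra ℂ A] [Algebra.Smooth ℂ A]
  {Γ : Type*} [Group Γ] [MulSemiringAction Γ A] [SMulCommClass Γ ℂ A]
  {m : ℕ} {ω : Form A (m + 2)}

theorem IsVolumeForm.smul_mem_volumeLieAlg [IsReduced A] (hω : IsVolumeForm ω) {ξ : VectorField A}
    (hinv : IsInvariantField Γ ξ) (hint : IsCompletelyIntegrable ξ) (hdiv : IsDivergenceFree ω ξ)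
    {f : Invariants Γ A} (hf : ξ (f : A) = 0) : (f : A) • ξ ∈ volumeLieAlg Γ ω :=
  LieSubalgebra.subset_lieSpan
    ⟨hinv.smul f, hint.smul hf, hω.isDivergenceFree_smul hdiv hf⟩

/-- For a product `f g` the field is `[f ξ, g η]`, by `IsVolumeForm.interior_lie`; the rest is
linearity in `h`. -/
theorem IsVolumeForm.exists_field_of_mem_kerProductSpan [IsReduced A] (hω : IsVolumeForm ω)
    {ξ η : VectorField A}
    (hpair : IsSemiCompatible Γ ξ η) (hξ : IsDivergenceFree ω ξ) (hη : IsDivergenceFree ω η)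
    {h : Invariants Γ A} (hh : h ∈ kerProductSpan Γ ξ η) :
    ∃ ζ ∈ volumeLieAlg Γ ω, interior ζ ω = extDeriv ((h : A) • interior ξ (interior η ω)) := by
  induction hh using Submodule.span_induction with
  | mem _ hh =>
    obtain ⟨f, hf, g, hg, rfl⟩ := hh
    refine ⟨⁅(f : A) • ξ, (g : A) • η⁆, LieSubalgebra.lie_mem _
      (hω.smul_mem_volumeLieAlg hpair.invariant_left hpair.integrable_left hξ hf)
      (hω.smul_mem_volumeLieAlg hpair.invariant_right hpair.integrable_right hη hg), ?_⟩
    rw [hω.interior_lie (hω.isDivergenceFree_smul hξ hf) (hω.isDivergenceFree_smul hη hg),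
      interior_smul_field, interior_smul_field, interior_smul_form, smul_smul]
    rfl
  | zero =>
    refine ⟨0, zero_mem _, ?_⟩
    rw [ZeroMemClass.coe_zero, zero_smul, map_zero]
    exact map_zero ω.curryLeft
  | add f g _ _ h1 h2 =>
    obtain ⟨ζ, hζ, e1⟩ := h1
    obtain ⟨ρ, hρ, e2⟩ := h2
    refine ⟨ζ + ρ, add_mem hζ hρ, ?_⟩
    rw [interior_add_field, e1, e2, ← map_add, ← add_smul]
    rfl
  | smul c f _ h1 =>
    obtain ⟨ζ, hζ, e1⟩ := h1
    refine ⟨c • ζ, (volumeLieAlg Γ ω).smul_mem c hζ, ?_⟩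
    rw [interior_smul_complex, e1, ← map_smul, ← smul_assoc]
    rfl

/-- Contraction is onto the fiber of forms, and bivectors are spanned by decomposable ones. This
settles the case `V = Λ² TX`. -/
theorem IsVolumeForm.valueAt_mem_span_interior (hω : IsVolumeForm ω) (x : A →ₐ[ℂ] ℂ)
    (τ : Form A m) : valueAt x τ ∈ Submodule.span ℂ {θ : Fiber x (Form A m) |
      ∃ ξ η : VectorField A, θ = valueAt x (interior ξ (interior η ω))} := by
  obtain ⟨B, hB⟩ := hω.exists_valueAt_contract x τ
  rw [← hB]
  have hB' : B ∈ (⊤ : Submodule A (Bivector A)) := trivial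
  rw [← exteriorPower.ιMulti_span] at hB'
  clear hB
  induction hB' using Submodule.span_induction with
  | mem _ h =>
    obtain ⟨v, rfl⟩ := h
    exact Submodule.subset_span ⟨v 0, v 1, by rw [contract_ιMulti]; rfl⟩
  | zero => rw [map_zero]; exact zero_mem _
  | add _ _ _ _ h1 h2 => rw [map_add]; exact add_mem h1 h2
  | smul a _ _ h => rw [map_smul, valueAt_smul]; exact Submodule.smul_mem _ _ h

end LieAlgebra

end
end AffineVar

/-! ### The main theorem -/

theorem mainTheorem7 {A : Type*} [CommRing A] [IsDomain A] [Algebra ℂ A] [Algebra.Smooth ℂ A]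
    {Γ : Type*} [Group Γ] [Finite Γ] [MulSemiringAction Γ A] [SMulCommClass Γ ℂ A]
    {m : ℕ} (ω : AffineVar.Form A (m + 2)) (hω : AffineVar.IsVolumeForm ω)
    (χ : Γ →* ℂˣ) (hχ : ω ∈ AffineVar.quasiInvariantForms A χ (m + 2))
    {k : ℕ} (ξ η : Fin k → AffineVar.VectorField A)
    (hpair : ∀ j, AffineVar.IsSemiCompatible Γ (ξ j) (η j))
    (hξ : ∀ j, AffineVar.interior (ξ j) ω ∈ AffineVar.exactForms A m)
    (hη : ∀ j, AffineVar.interior (η j) ω ∈ AffineVar.exactForms A m)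
    (V : ∀ x : A →ₐ[ℂ] ℂ, Submodule ℂ (AffineVar.Fiber x (AffineVar.Bivector A)))
    (hV : AffineVar.IsSubbundle V)
    (hA : ∀ x : A →ₐ[ℂ] ℂ, Submodule.span ℂ
      {w | ∃ j, ∃ f ∈ AffineVar.associateIdeal Γ (ξ j) (η j),
        w = x (f : A) • AffineVar.valueAt x (AffineVar.wedge (ξ j) (η j))} = V x) :
    (∀ τ ∈ AffineVar.dualForms χ ω V,
      ∃ ζ ∈ AffineVar.volumeLieAlg Γ ω, AffineVar.interior ζ ω = AffineVar.extDeriv τ) ∧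
    ((∀ x, V x = ⊤) →
      ∀ σ ∈ AffineVar.exactQuasiInvariantForms A χ m,
        ∃ ζ ∈ AffineVar.volumeLieAlg Γ ω, AffineVar.interior ζ ω = σ) := by
  open AffineVar in
  have := Fintype.ofFinite Γ
  let S : Set (Bivector A) :=
    {B | ∃ j, ∃ f ∈ associateIdeal Γ (ξ j) (η j), B = (f : A) • wedge (ξ j) (η j)}
  have hS : ∀ x, Submodule.span ℂ (valueAt x '' S) = V x := by
    intro x
    rw [← hA x]
    congr 1
    ext w
    constructor
    · rintro ⟨_, ⟨j, f, hf, rfl⟩, rfl⟩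
      exact ⟨j, f, hf, valueAt_smul x _ _⟩
    · rintro ⟨j, f, hf, rfl⟩
      exact ⟨_, ⟨j, f, hf, rfl⟩, valueAt_smul x _ _⟩
  have hquasi : ∀ j, interior (ξ j) (interior (η j) ω) ∈ quasiInvariantForms A χ m := by
    intro j γ
    rw [formAction_interior_of_invariant (hpair j).invariant_left,
      formAction_interior_of_invariant (hpair j).invariant_right, hχ γ]
    rfl
  have hfield : ∀ τ ∈ Submodule.span A (contract ω '' S),
      ∃ ζ ∈ volumeLieAlg Γ ω, interior ζ ω = extDeriv (quasiAverage χ τ) := by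
    intro τ hτ
    -- Averaging is additive but not `A`-linear, so the span is treated as the additive closure of
    -- the multiples `a • σ` of generators.
    induction hτ using Submodule.closure_induction with
    | zero =>
      refine ⟨0, zero_mem _, ?_⟩
      rw [quasiAverage_zero, map_zero]
      exact map_zero ω.curryLeft
    | add σ τ _ _ h1 h2 =>
      obtain ⟨ζ, hζ, e1⟩ := h1
      obtain ⟨ρ, hρ, e2⟩ := h2
      exact ⟨ζ + ρ, add_mem hζ hρ, by
        rw [interior_add_field, e1, e2, ← map_add, quasiAverage_add]⟩
    | smul_mem a σ hσ =>
      obtain ⟨_, ⟨j, f, hf, rfl⟩, rfl⟩ := hσ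
      -- Here it matters that `f` lies in an ideal inside the span of products: the span itself need
      -- not absorb the averaged coefficient.
      have hmem : averageFun Γ a * f ∈ kerProductSpan Γ (ξ j) (η j) :=
        (associateIdeal_isGreatest Γ (ξ j) (η j)).1 (Ideal.mul_mem_left _ _ hf)
      have hav : quasiAverage χ (a • contract ω ((f : A) • wedge (ξ j) (η j)))
          = ((averageFun Γ a * f : Invariants Γ A) : A) • interior (ξ j) (interior (η j) ω) := by
        have hqf : (f : A) • interior (ξ j) (interior (η j) ω) ∈ quasiInvariantForms A χ m := by
          intro γ
          have hfγ : γ • (f : A) = f := f.2 γ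
          rw [formAction_smul, hquasi j γ, hfγ, smul_comm]
        rw [map_smul, contract_wedge, quasiAverage_smul χ a hqf, smul_smul]
        rfl
      rw [hav]
      exact hω.exists_field_of_mem_kerProductSpan (hpair j)
        (hω.isDivergenceFree_of_exact (hξ j)) (hω.isDivergenceFree_of_exact (hη j)) hmem
  have hmain : ∀ τ ∈ dualForms χ ω V,
      ∃ ζ ∈ volumeLieAlg Γ ω, interior ζ ω = extDeriv τ := by
    rintro τ ⟨hτ, hτV⟩
    have h := hfield τ (hω.mem_span_contract hV hS hτV)
    rwa [quasiAverage_of_mem χ hτ] at h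
  refine ⟨hmain, fun htop σ hσ => ?_⟩
  obtain ⟨hσχ, ρ, rfl⟩ := hσ
  -- The primitive `ρ` need not be quasi-invariant; its average is, and has the same differential
  -- because `dρ` is quasi-invariant.
  have h := hmain (quasiAverage χ ρ) ⟨quasiAverage_mem χ ρ, fun x => by
    simpa [htop x] using hω.valueAt_mem_span_interior x (quasiAverage χ ρ)⟩
  rwa [← quasiAverage_extDeriv, quasiAverage_of_mem χ hσχ] at h
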